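/- Let $a_1,\dots,a_n\in\mathbb Z^d$ be nonzero vectors spanning a sublattice of rank $d$, and let $\mathcal A$ be the central arrangement of the (possibly repeated) hyperplanes $H_i=\{v\mid v\cdot a_i=0\}$ in $d$-dimensional space, which may be realized over any field. Let $T^k$ be the kernel of the homomorphism of split tori $T^n\to T^d$ over $\mathbb Z$ given on cocharacters by $x_i\mapsto a_i$. It acts on $T^*\mathbb A^n$ with coordinates $(z,w)$ by $t\cdot(z,w)=(tz,t^{-1}w)$; let $\mu^{-1}(0)\subseteq T^*\mathbb A^n$ be the closed subscheme given by the equations $\sum_i b_iz_iw_i=0$ for all $b\in\ker(\mathbb Z^n\to\mathbb Z^d)$. The central hypertoric variety is $\mathfrak M(\mathcal A)=\operatorname{Spec}\,\mathcal O(\mu^{-1}(0))^{T^k}$. Write $[z,w]$ for the image in $\mathfrak M(\mathcal A)$ of a point $(z,w)$ of $\mu^{-1}(0)$ with closed $T^k$-orbit. The generic stratum $\mathring{\mathfrak M}(\mathcal A)$ is the open subscheme of points $[z,w]$ for which there is no $i$ with $z_i=w_i=0$ (equivalently, the complement of the images of the loci $\{z_i=w_i=0\}$, $1\le i\le n$).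 A variety $X$ over $\mathbb Z$ has polynomial point count if there is a polynomial $\nu_X$ such that $\nu_X(q)=|X(\mathbb F_q)|$ whenever $q$ is a power of a sufficiently large prime. A flat is a subset $F\subseteq\{1,\dots,n\}$ such that $F=\{i\mid H_i\supseteq H_F\}$ over $\mathbb R$, where $H_F=\bigcap_{i\in F}H_i$. For a flat $F$, let $\mathcal A^F=\{H_i\cap H_F\mid i\notin F\}$, an arrangement in $H_F$, be the restriction, and let $\mathcal A_F=\{H_i/H_F\mid i\in F\}$, an arrangement in the quotient of the ambient space by $H_F$, be the localization. Then, for every flat $F$, the complement $M(\mathcal A^F)=H_F\smallsetminus\bigcup_{i\notin F}H_i$ has polynomial point count; its counting polynomial is the characteristic polynomial $\chi_{\mathcal A^F}$. Let $r(\mathcal A_F)$ be the number of connected components of the complement of $\mathcal A_F$ over $\mathbb R$. The generic stratum $\mathring{\mathfrak M}(\mathcal A)$ has polynomial point count, with $$\nu_{\mathring{\mathfrak M}(\mathcal A)}(q)=(q-1)^d\cdot\sum_F\chi_{\mathcal A^F}(q)\cdot r(\mathcal A_F),$$ where the sum is over all flats $F$ of $\mathcal A$. -/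

import Mathlib

open AlgebraicGeometry CategoryTheory

noncomputable section

/-! ### Point counts -/

/-- `X` assigns to each field `K` the set `X(K)` of `K`-points of a variety defined over `ℤ`.
The polynomial `ν` counts the points of `X` if, for every finite field `K` whose order is a power
of a sufficiently large prime, the set `X(K)` is finite and has exactly `ν(|K|)` elements. -/
def HasPointCount (X : (K : Type) → [Field K] → Type) (ν : Polynomial ℤ) : Prop :=
  ∃ N : ℕ, ∀ (K : Type) [Field K] [Finite K], N < ringChar K →
    Finite (X K) ∧ (Nat.card (X K) : ℤ) = ν.eval (Nat.card K : ℤ)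

/-- The variety has polynomial point count. -/
def HasPolynomialPointCount (X : (K : Type) → [Field K] → Type) : Prop :=
  ∃ ν : Polynomial ℤ, HasPointCount X ν

/-- The counting polynomial is unique. -/
theorem HasPointCount.unique {X : (K : Type) → [Field K] → Type} {ν ν' : Polynomial ℤ}
    (h : HasPointCount X ν) (h' : HasPointCount X ν') : ν = ν' := by
  obtain ⟨N, hN⟩ := h
  obtain ⟨N', hN'⟩ := h'
  have hinf : {p : ℕ | p.Prime ∧ max N N' < p}.Infinite := by
    refine Set.infinite_of_not_bddAbove ?_
    rintro ⟨B, hB⟩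
    obtain ⟨p, hp, hpp⟩ := Nat.exists_infinite_primes (max B (max N N') + 1)
    have := hB (show p ∈ {p : ℕ | p.Prime ∧ max N N' < p} from ⟨hpp, by omega⟩)
    omega
  refine Polynomial.eq_of_infinite_eval_eq ν ν'
    ((hinf.image (f := fun p : ℕ => (p : ℤ)) Nat.cast_injective.injOn).mono ?_)
  rintro _ ⟨p, ⟨hp, hlt⟩, rfl⟩
  have : Fact p.Prime := ⟨hp⟩
  have hc : ringChar (ZMod p) = p := ringChar.eq (ZMod p) p
  have h1 := (hN (ZMod p) (by omega)).2
  have h2 := (hN' (ZMod p) (by omega)).2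
  simpa using h1.symm.trans h2

/-- The polynomial `ν_X` that counts the points of `X` (and `0` if there is none). -/
def pointCountPolynomial (X : (K : Type) → [Field K] → Type) : Polynomial ℤ :=
  open Classical in if h : HasPolynomialPointCount X then h.choose else 0

/-! ### Central hyperplane arrangements -/

namespace Arrangement

variable {ι K V : Type*} [Field K] [AddCommGroup V] [Module K V]

/-- The complement of the union of a family of hyperplanes through the origin. -/
def complement (H : ι → Submodule K V) : Set V := {v | ∀ i, v ∉ H i}

/-- `H_S`, the intersection of the hyperplanes indexed by `S`. -/
def inter (H : ι → Submodule K V) (S : Finset ι) : Submodule K V := ⨅ i ∈ S, H i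

/-- `F` is a flat if `F = {i | H_i ⊇ H_F}`. -/
def IsFlat (H : ι → Submodule K V) (F : Finset ι) : Prop := ∀ i, i ∈ F ↔ inter H F ≤ H i

/-- The restriction: the arrangement of the `H_i ∩ H_F`, `i ∉ F`, in the space `H_F`. -/
def restriction (H : ι → Submodule K V) (F : Finset ι) :
    {i // i ∉ F} → Submodule K (inter H F) :=
  fun i => (H i).comap (inter H F).subtype

/-- The localization: the arrangement of the `H_i / H_F`, `i ∈ F`, in the space `V / H_F`. -/
def localization (H : ι → Submodule K V) (F : Finset ι) :
    {i // i ∈ F} → Submodule K (V ⧸ inter H F) :=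
  fun i => (H i).map (inter H F).mkQ

/-- The number of connected components of the complement of a real arrangement. -/
def numRegions {W : Type*} [AddCommGroup W] [Module ℝ W] [TopologicalSpace W]
    (H : ι → Submodule ℝ W) : ℕ :=
  Nat.card (ConnectedComponents (complement H))

end Arrangement

namespace Hypertoric

variable {d n : ℕ}

/-- The hyperplane `H_i = {v | v · a_i = 0}`, realized over the field `K`. -/
def hyperplane (a : Fin n → Fin d → ℤ) (K : Type*) [Field K] (i : Fin n) :
    Submodule K (Fin d → K) :=
  LinearMap.ker (Fintype.linearCombination K (fun j => (a i j : K)))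

/-- The finite set of flats of the (real) arrangement. -/
def flats (a : Fin n → Fin d → ℤ) : Finset (Finset (Fin n)) :=
  open Classical in Finset.univ.filter (fun F => Arrangement.IsFlat (hyperplane a ℝ) F)

/-- The `K`-points of the complement of the restricted arrangement `𝒜^F`. -/
def RestrictionComplement (a : Fin n → Fin d → ℤ) (F : Finset (Fin n)) (K : Type) [Field K] :
    Type :=
  Arrangement.complement (Arrangement.restriction (hyperplane a K) F)

/-- The characteristic polynomial of `𝒜^F`, i.e. the polynomial that counts the points of its
complement over finite fields. -/
def restrictionCharPoly (a : Fin n → Fin d → ℤ) (F : Finset (Fin n)) : Polynomial ℤ :=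
  pointCountPolynomial (fun K _ => RestrictionComplement a F K)

/-- `r(𝒜_F)`, the number of chambers of the localized real arrangement. -/
def localizationRegions (a : Fin n → Fin d → ℤ) (F : Finset (Fin n)) : ℕ :=
  Arrangement.numRegions (Arrangement.localization (hyperplane a ℝ) F)

/-! ### The hypertoric variety

`T^k` is the kernel of the homomorphism of split tori `T^n → T^d` whose map on cocharacters is
`x_i ↦ a_i`. It is a diagonalizable group scheme over `ℤ` with character group
`ℤ^n / {(⟨m, a_i⟩)_i | m ∈ ℤ^d}`, and its Lie algebra is the kernel of `ℤ^n → ℤ^d`. -/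

/-- The coordinate ring `ℤ[z_1, …, z_n, w_1, …, w_n]` of the cotangent bundle of affine space;
`Sum.inl i` is the index of `z_i` and `Sum.inr i` that of `w_i`. -/
abbrev CotangentRing (n : ℕ) : Type := MvPolynomial (Fin n ⊕ Fin n) ℤ

/-- The Lie algebra of `T^k`, the kernel of `ℤ^n → ℤ^d`, `x_i ↦ a_i`. -/
def lieKernel (a : Fin n → Fin d → ℤ) : Submodule ℤ (Fin n → ℤ) :=
  LinearMap.ker (Fintype.linearCombination ℤ a)

/-- The component of the moment map along `b ∈ Lie(T^k)`, namely `∑ b_i z_i w_i`. -/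
def momentComponent (b : Fin n → ℤ) : CotangentRing n :=
  ∑ i, MvPolynomial.C (b i) * (MvPolynomial.X (Sum.inl i) * MvPolynomial.X (Sum.inr i))

/-- The ideal of `μ⁻¹(0)`. -/
def momentIdeal (a : Fin n → Fin d → ℤ) : Ideal (CotangentRing n) :=
  Ideal.span (momentComponent '' (lieKernel a : Set (Fin n → ℤ)))

/-- The coordinate ring of `μ⁻¹(0)`. -/
abbrev ZeroFiberRing (a : Fin n → Fin d → ℤ) : Type := CotangentRing n ⧸ momentIdeal a

/-- The function `z_i` on `μ⁻¹(0)`. -/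
def zCoord (a : Fin n → Fin d → ℤ) (i : Fin n) : ZeroFiberRing a :=
  Ideal.Quotient.mk _ (MvPolynomial.X (Sum.inl i))

/-- The function `w_i` on `μ⁻¹(0)`. -/
def wCoord (a : Fin n → Fin d → ℤ) (i : Fin n) : ZeroFiberRing a :=
  Ideal.Quotient.mk _ (MvPolynomial.X (Sum.inr i))

/-- The characters of `T^n` that are trivial on `T^k`, i.e. pulled back from `T^d`. -/
def trivialCharacters (a : Fin n → Fin d → ℤ) : Submodule ℤ (Fin n → ℤ) :=
  LinearMap.range (Matrix.mulVecLin (Matrix.of a))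

/-- The character group of `T^k`. -/
abbrev CharacterGroup (a : Fin n → Fin d → ℤ) : Type := (Fin n → ℤ) ⧸ trivialCharacters a

/-- The restriction to `T^k` of the `i`-th coordinate character of `T^n`. -/
def character (a : Fin n → Fin d → ℤ) (i : Fin n) : CharacterGroup a :=
  (trivialCharacters a).mkQ (Pi.single i 1)

/-- The ring `𝒪(T^k) ⊗ 𝒪(μ⁻¹(0))` of functions on `T^k × μ⁻¹(0)`: since `T^k` is diagonalizable,
`𝒪(T^k)` is the group ring of its character group. -/
abbrev ActionRing (a : Fin n → Fin d → ℤ) : Type :=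
  AddMonoidAlgebra (ZeroFiberRing a) (CharacterGroup a)

/-- The map on functions induced by the action of `T^k` on the cotangent bundle, restricted to
`T^k × μ⁻¹(0)`: `z_i ↦ t_i ⊗ z_i` and `w_i ↦ t_i⁻¹ ⊗ w_i`. -/
def coactionLift (a : Fin n → Fin d → ℤ) : CotangentRing n →+* ActionRing a :=
  (MvPolynomial.aeval (Sum.elim
    (fun i => AddMonoidAlgebra.single (character a i) (zCoord a i))
    (fun i => AddMonoidAlgebra.single (-character a i) (wCoord a i)))).toRingHom

theorem coactionLift_momentComponent (a : Fin n → Fin d → ℤ) (b : Fin n → ℤ) :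
    coactionLift a (momentComponent b) =
      AddMonoidAlgebra.single 0 (Ideal.Quotient.mk (momentIdeal a) (momentComponent b)) := by
  have key : ∀ i, coactionLift a (MvPolynomial.C (b i) *
      (MvPolynomial.X (Sum.inl i) * MvPolynomial.X (Sum.inr i))) =
      AddMonoidAlgebra.singleZeroRingHom (Ideal.Quotient.mk (momentIdeal a) (MvPolynomial.C (b i) *
        (MvPolynomial.X (Sum.inl i) * MvPolynomial.X (Sum.inr i)))) := by
    intro i
    have hC : coactionLift a (MvPolynomial.C (b i)) = ((b i : ℤ) : ActionRing a) := by
      simp [coactionLift]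
    have hX : coactionLift a (MvPolynomial.X (Sum.inl i)) =
        AddMonoidAlgebra.single (character a i) (zCoord a i) := by simp [coactionLift]
    have hY : coactionLift a (MvPolynomial.X (Sum.inr i)) =
        AddMonoidAlgebra.single (-character a i) (wCoord a i) := by simp [coactionLift]
    rw [map_mul, map_mul, hC, hX, hY, AddMonoidAlgebra.single_mul_single, map_mul, map_mul,
      add_neg_cancel]
    congr 1
  rw [momentComponent, map_sum, map_sum]
  simp_rw [key]
  rw [← map_sum]
  rfl

/-- The coaction `ν^* : 𝒪(μ⁻¹(0)) → 𝒪(T^k) ⊗ 𝒪(μ⁻¹(0))`. -/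
def coaction (a : Fin n → Fin d → ℤ) : ZeroFiberRing a →+* ActionRing a :=
  Ideal.Quotient.lift (momentIdeal a) (coactionLift a) (by
    intro f hf
    have : momentIdeal a ≤ RingHom.ker (coactionLift a) := by
      refine Ideal.span_le.2 ?_
      rintro _ ⟨b, hb, rfl⟩
      have h0 : Ideal.Quotient.mk (momentIdeal a) (momentComponent b) = 0 :=
        Ideal.Quotient.eq_zero_iff_mem.2 (Ideal.subset_span ⟨b, hb, rfl⟩)
      simp [RingHom.mem_ker, coactionLift_momentComponent, h0]
    exact this hf)

/-- The ring of `T^k`-invariant functions on `μ⁻¹(0)`, i.e. those with `ν^* f = 1 ⊗ f`. -/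
def invariantRing (a : Fin n → Fin d → ℤ) : Subring (ZeroFiberRing a) :=
  RingHom.eqLocus (coaction a) AddMonoidAlgebra.singleZeroRingHom

/-- The scheme `μ⁻¹(0)` over `ℤ`. -/
def zeroFiber (a : Fin n → Fin d → ℤ) : Scheme.{0} := Spec (.of (ZeroFiberRing a))

/-- The hypertoric variety `𝔐(𝒜) = μ⁻¹(0) // T^k`, the spectrum of the ring of invariants. -/
def variety (a : Fin n → Fin d → ℤ) : Scheme.{0} := Spec (.of (invariantRing a))

/-- The quotient map `μ⁻¹(0) → 𝔐(𝒜)`. -/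
def quotientMap (a : Fin n → Fin d → ℤ) : zeroFiber a ⟶ variety a :=
  Spec.map (CommRingCat.ofHom (invariantRing a).subtype)

/-- The locus `z_i = w_i = 0` in `μ⁻¹(0)`. -/
def coordLocus (a : Fin n → Fin d → ℤ) (i : Fin n) : Set (zeroFiber a) :=
  PrimeSpectrum.zeroLocus {zCoord a i, wCoord a i}

/-- Functions on `μ⁻¹(0)` are sums of weight vectors for the action of `T^k`. -/
theorem mem_closure_weight (a : Fin n → Fin d → ℤ) (s : ZeroFiberRing a) :
    s ∈ AddSubgroup.closure
      {s : ZeroFiberRing a | ∃ m, coaction a s = AddMonoidAlgebra.single m s} := by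
  obtain ⟨f, rfl⟩ := Ideal.Quotient.mk_surjective s
  induction f using MvPolynomial.induction_on' with
  | add p q hp hq => rw [map_add]; exact add_mem hp hq
  | monomial u c =>
    refine AddSubgroup.subset_closure ?_
    have hmul : ∀ x y : ZeroFiberRing a,
        (∃ m, coaction a x = AddMonoidAlgebra.single m x) →
        (∃ m, coaction a y = AddMonoidAlgebra.single m y) →
        ∃ m, coaction a (x * y) = AddMonoidAlgebra.single m (x * y) := by
      rintro x y ⟨m, hm⟩ ⟨m', hm'⟩
      exact ⟨m + m', by rw [map_mul, hm, hm', AddMonoidAlgebra.single_mul_single]⟩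
    change ∃ m, coaction a _ = AddMonoidAlgebra.single m _
    induction u using Finsupp.induction with
    | zero =>
      refine ⟨0, ?_⟩
      change coaction a (Ideal.Quotient.mk _ (MvPolynomial.C c)) =
        AddMonoidAlgebra.singleZeroRingHom (Ideal.Quotient.mk _ (MvPolynomial.C c))
      simp
    | single_add i k u hi hk ih =>
      rw [MvPolynomial.monomial_single_add, map_mul, map_pow]
      refine hmul _ _ ?_ ih
      clear ih hk
      induction k with
      | zero =>
        refine ⟨0, ?_⟩
        simp only [pow_zero, map_one]
        rfl
      | succ k ih =>
        rw [pow_succ]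
        refine hmul _ _ ih ?_
        rcases i with i | i
        · exact ⟨character a i, by simp [coaction, coactionLift, zCoord]⟩
        · exact ⟨-character a i, by simp [coaction, coactionLift, wCoord]⟩

/-- The projection of a function on `μ⁻¹(0)` to its `T^k`-invariant part. -/
def invariantPart (a : Fin n → Fin d → ℤ) : ZeroFiberRing a →+ ZeroFiberRing a where
  toFun s := (coaction a s).coeff 0
  map_zero' := by simp
  map_add' := by simp

theorem invariantPart_mem (a : Fin n → Fin d → ℤ) (s : ZeroFiberRing a) :
    invariantPart a s ∈ invariantRing a := by
  have h := mem_closure_weight a s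
  induction h using AddSubgroup.closure_induction with
  | mem x hx =>
    obtain ⟨m, hm⟩ := hx
    by_cases h0 : m = 0
    · subst h0
      have : invariantPart a x = x := by simp [invariantPart, hm]
      rw [this]
      exact hm
    · have : invariantPart a x = 0 := by simp [invariantPart, hm, h0]
      rw [this]
      exact zero_mem _
  | zero => rw [map_zero]; exact zero_mem _
  | add x y _ _ hx hy => rw [map_add]; exact add_mem hx hy
  | neg x _ hx => rw [map_neg]; exact neg_mem hx

theorem invariantPart_mul (a : Fin n → Fin d → ℤ) (r s : ZeroFiberRing a)
    (hr : r ∈ invariantRing a) : invariantPart a (r * s) = r * invariantPart a s := by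
  have h : coaction a r = AddMonoidAlgebra.single 0 r := hr
  simp [invariantPart, h]

theorem invariantPart_of_mem (a : Fin n → Fin d → ℤ) (r : ZeroFiberRing a)
    (hr : r ∈ invariantRing a) : invariantPart a r = r := by
  have h : coaction a r = AddMonoidAlgebra.single 0 r := hr
  simp [invariantPart, h]

/-- The ideal of the locus `z_i = w_i = 0`. -/
def coordIdeal (a : Fin n → Fin d → ℤ) (i : Fin n) : Ideal (ZeroFiberRing a) :=
  Ideal.span {zCoord a i, wCoord a i}

theorem invariantPart_mem_coordIdeal (a : Fin n → Fin d → ℤ) (i : Fin n) (s : ZeroFiberRing a)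
    (hs : s ∈ coordIdeal a i) : invariantPart a s ∈ coordIdeal a i := by
  obtain ⟨x, y, rfl⟩ := Ideal.mem_span_pair.1 hs
  have hz : coaction a (zCoord a i) = AddMonoidAlgebra.single (character a i) (zCoord a i) := by
    simp [coaction, coactionLift, zCoord]
  have hw : coaction a (wCoord a i) = AddMonoidAlgebra.single (-character a i) (wCoord a i) := by
    simp [coaction, coactionLift, wCoord]
  have h : invariantPart a (x * zCoord a i + y * wCoord a i) =
      (coaction a x).coeff (-character a i) * zCoord a i +
        (coaction a y).coeff (character a i) * wCoord a i := by
    simp [invariantPart, hz, hw]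
  rw [h]
  exact Ideal.mem_span_pair.2 ⟨_, _, rfl⟩

/-- The image of the locus `z_i = w_i = 0` under the quotient map is closed: it is cut out by the
invariant functions that vanish on that locus. -/
theorem image_coordLocus (a : Fin n → Fin d → ℤ) (i : Fin n) :
    quotientMap a '' coordLocus a i =
      (PrimeSpectrum.zeroLocus ((coordIdeal a i).comap (invariantRing a).subtype :
        Set (invariantRing a)) : Set (PrimeSpectrum (invariantRing a))) := by
  ext x
  constructor
  · rintro ⟨y, hy, rfl⟩
    have hy' : coordIdeal a i ≤ PrimeSpectrum.asIdeal y := Ideal.span_le.2 hy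
    intro r hr
    exact hy' hr
  · intro hx
    let P : Ideal (invariantRing a) := PrimeSpectrum.asIdeal x
    have hPprime : P.IsPrime := PrimeSpectrum.isPrime x
    have hxP : (coordIdeal a i).comap (invariantRing a).subtype ≤ P := hx
    have hext : ∀ s ∈ P.map (invariantRing a).subtype, ∀ c,
        ∃ p ∈ P, (p : ZeroFiberRing a) = invariantPart a (s * c) := by
      intro s hs
      induction hs using Submodule.span_induction with
      | mem s hs =>
        obtain ⟨p, hp, rfl⟩ := hs
        intro c
        refine ⟨p * ⟨invariantPart a c, invariantPart_mem a c⟩, P.mul_mem_right _ hp, ?_⟩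
        exact (invariantPart_mul a _ c p.2).symm
      | zero => exact fun c => ⟨0, P.zero_mem, by simp⟩
      | add s t _ _ hs ht =>
        intro c
        obtain ⟨p, hp, hps⟩ := hs c
        obtain ⟨q, hq, hqt⟩ := ht c
        exact ⟨p + q, P.add_mem hp hq, by simp [hps, hqt, add_mul]⟩
      | smul c s _ hs =>
        intro c'
        obtain ⟨p, hp, hps⟩ := hs (c * c')
        exact ⟨p, hp, by rw [hps, smul_eq_mul]; congr 1; ring⟩
    have hdisj : Disjoint ((coordIdeal a i ⊔ P.map (invariantRing a).subtype :
        Ideal (ZeroFiberRing a)) : Set (ZeroFiberRing a))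
        (P.primeCompl.map (invariantRing a).subtype : Submonoid (ZeroFiberRing a)) := by
      rw [Set.disjoint_left]
      rintro _ hs ⟨r, hr, rfl⟩
      apply hr
      obtain ⟨s, hs, t, ht, hst⟩ := Submodule.mem_sup.1 hs
      obtain ⟨p, hp, hpt⟩ := hext t ht 1
      have hq : (⟨invariantPart a s, invariantPart_mem a s⟩ : invariantRing a) ∈ P :=
        hxP (invariantPart_mem_coordIdeal a i s hs)
      have hr' : r = ⟨invariantPart a s, invariantPart_mem a s⟩ + p := by
        apply Subtype.ext
        have h1 := invariantPart_of_mem a _ r.2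
        change (r : ZeroFiberRing a) = invariantPart a s + p
        rw [hpt, mul_one, ← map_add, hst]
        exact h1.symm
      rw [hr']
      exact P.add_mem hq hp
    obtain ⟨Q, hQ, hle, hdis⟩ := Ideal.exists_le_prime_disjoint _ _ hdisj
    refine ⟨(⟨Q, hQ⟩ : PrimeSpectrum (ZeroFiberRing a)), ?_, ?_⟩
    · exact Ideal.span_le.1 (le_sup_left.trans hle)
    · refine PrimeSpectrum.ext (le_antisymm ?_ ?_)
      · intro r hr
        by_contra hrP
        exact Set.disjoint_left.1 hdis hr ⟨r, hrP, rfl⟩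
      · intro r hr
        exact hle (le_sup_right (a := coordIdeal a i) (Ideal.mem_map_of_mem _ hr))

theorem isClosed_image_coordLocus (a : Fin n → Fin d → ℤ) (i : Fin n) :
    IsClosed (quotientMap a '' coordLocus a i) := by
  rw [image_coordLocus]
  exact PrimeSpectrum.isClosed_zeroLocus _

/-- The generic stratum of `𝔐(𝒜)`: the open subscheme of points `[z, w]` for which there is no `i`
with `z_i = w_i = 0`. Here `[z, w]` is the image of a point `(z, w)` with closed orbit. The closed
`T^k`-invariant set `z_i = w_i = 0` contains the closed orbit over a point of `𝔐(𝒜)` as soon as it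
meets the fiber of the quotient map over this point. So the points with `z_i = w_i = 0` form the
image of this set. -/
def genericStratum (a : Fin n → Fin d → ℤ) : (variety a).Opens where
  carrier := {x | ∀ i, x ∉ quotientMap a '' coordLocus a i}
  is_open' := by
    have : {x | ∀ i, x ∉ quotientMap a '' coordLocus a i} =
        (⋃ i, quotientMap a '' coordLocus a i)ᶜ := by
      ext x; simp only [Set.mem_ofPred_eq, Set.mem_compl_iff, Set.mem_iUnion, not_exists]
    rw [this]
    exact (isClosed_iUnion_of_finite (isClosed_image_coordLocus a)).isOpen_compl

/-- The `K`-points of the generic stratum. -/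
def GenericStratumPoints (a : Fin n → Fin d → ℤ) (K : Type) [Field K] : Type :=
  Spec (.of K) ⟶ (genericStratum a : Scheme.{0})

end Hypertoric

end

/-!
Let `h_i = z_i w_i`. For `m ∈ ℤ ^ d` let `x_m` be the monomial in the `z_i` and `w_i` that has
`T ^ n`-weight `(m · a_i)_i` and is divisible by no `h_i`. An invariant monomial has a weight of this
form, so it is `x_m` times a product of the `h_i`, and these products span the ring of invariants
(`closure_range_prod_hFun_mul_xFun`). The relations are generated by the moment map equations
`∑ b_i h_i = 0` and by `x_m x_m' = x_{m + m'} ∏ h_i ^ c_i`, where `c_i` (`overlap`) is positive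
exactly if `m · a_i` and `m' · a_i` have opposite signs; to see that there are no others, an
assignment of values that satisfies them is extended additively to the polynomial ring, by zero on
monomials that are not invariant (`ringHomOfTwistedCharacter`).

Consider a homomorphism from the ring of invariants to a finite field `K` of large characteristic.
The values of the `h_i` satisfy the moment map equations, so they are `v · a_i` for a unique
`v ∈ K ^ d` (`exists_pairing_eq`). Let `F` be the set of `i` with `v · a_i = 0`, which is a flat of
the real arrangement (`exists_mem_flats_of_exactZeroLocus`). The values `g m` of the `x_m` form a
character of `ℤ ^ d` twisted by the `h_i`. By the relations, no form `i ∈ F` takes opposite signs on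
the support of `g`, and genericity says that no form `i ∈ F` vanishes identically on this support.
Adding up points of the support gives one in the interior of a chamber of the localization at `F`,
and then the support is the set of all lattice points of the closed chamber. Untwisting by powers of
the nonzero `h_i` turns `g` into a homomorphism from this monoid to the units of `K`, and hence into
a point of the torus `(Kˣ) ^ d`, because the monoid generates `ℤ ^ d`. Conversely each chamber and
each point of the torus occur (`exists_chamber_prod_equiv`). So the fiber over `v` has
`r(𝒜_F) (q - 1) ^ d` points, and summing over `v` gives the formula.

The points `v` with zero set exactly `F` are those of the complement of the restriction to `F`. They
are counted by a polynomial because the intersections of hyperplanes have `q ^ e` points with `e`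
independent of `K` (`exists_card_inter`) and are disjoint unions of such loci. The connected
components of the complement of a real localization are recorded by the signs of the forms, as each
set of points with given signs is convex (`localizationRegions_eq_card_chamber`).
-/

noncomputable section

/-! ### Linear algebra over `ℤ` and over fields of large characteristic -/

/-- A nonzero integer stays nonzero in a field of large characteristic. -/
theorem intCast_ne_zero_of_lt_ringChar {K : Type*} [Field K] {z : ℤ} (hz : z ≠ 0)
    (h : z.natAbs < ringChar K) : (z : K) ≠ 0 := by
  intro h0
  have h1 := (CharP.intCast_eq_zero_iff K (ringChar K) z).1 h0
  have h2 := Int.natAbs_dvd_natAbs.2 h1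
  simp only [Int.natAbs_natCast] at h2
  exact absurd (Nat.le_of_dvd (Int.natAbs_pos.2 hz) h2) (by omega)

namespace Hypertoric

variable {d n : ℕ}

/-- The linear form `v ↦ v · a_i` with coefficients in a commutative ring `R`. -/
def pairing (a : Fin n → Fin d → ℤ) (R : Type*) [CommRing R] (i : Fin n) :
    (Fin d → R) →ₗ[R] R :=
  Fintype.linearCombination R (fun j => (a i j : R))

theorem pairing_apply (a : Fin n → Fin d → ℤ) (R : Type*) [CommRing R] (i : Fin n)
    (v : Fin d → R) : pairing a R i v = ∑ j, v j * (a i j : R) := by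
  simp [pairing, Fintype.linearCombination_apply]

theorem mem_hyperplane {a : Fin n → Fin d → ℤ} {K : Type*} [Field K] {i : Fin n}
    {v : Fin d → K} : v ∈ hyperplane a K i ↔ pairing a K i v = 0 :=
  Iff.rfl

theorem pairing_intCast (a : Fin n → Fin d → ℤ) (R : Type*) [CommRing R] (i : Fin n)
    (m : Fin d → ℤ) : pairing a R i (fun j => (m j : R)) = (pairing a ℤ i m : R) := by
  simp [pairing_apply]

theorem mem_inter_hyperplane {a : Fin n → Fin d → ℤ} {K : Type*} [Field K]
    {S : Finset (Fin n)} {v : Fin d → K} :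
    v ∈ Arrangement.inter (hyperplane a K) S ↔ ∀ i ∈ S, pairing a K i v = 0 := by
  simp [Arrangement.inter, mem_hyperplane]

/-- Either a multiple of `x` is an integral combination of the `a_i`, `i ∈ S`, or some integral
vector is orthogonal to these `a_i` but not to `x`. -/
theorem exists_combination_or_exists_orthogonal (a : Fin n → Fin d → ℤ) (S : Finset (Fin n))
    (x : Fin d → ℤ) :
    (∃ N : ℤ, N ≠ 0 ∧ ∃ c : Fin n → ℤ, ∀ j, N * x j = ∑ i ∈ S, c i * a i j) ∨
      ∃ m : Fin d → ℤ, (∀ i ∈ S, pairing a ℤ i m = 0) ∧ ∑ j, m j * x j ≠ 0 := by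
  classical
  let aq : Fin n → Fin d → ℚ := fun i j => (a i j : ℚ)
  let xq : Fin d → ℚ := fun j => (x j : ℚ)
  by_cases hx : xq ∈ Submodule.span ℚ (aq '' S)
  · left
    obtain ⟨c, hc⟩ := (Submodule.mem_span_image_finset_iff_exists_fun ℚ).1 hx
    obtain ⟨b, hb⟩ := IsLocalization.exist_integer_multiples_of_finite (nonZeroDivisors ℤ) c
    choose e he using hb
    refine ⟨b, nonZeroDivisors.ne_zero b.2, fun i => if h : i ∈ S then e ⟨i, h⟩ else 0,
      fun j => ?_⟩
    have h1 := congrFun hc j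
    simp only [Finset.sum_apply, Pi.smul_apply, smul_eq_mul, aq, xq] at h1
    have h2 : ∀ i, (e i : ℚ) = ((b : ℤ) : ℚ) * c i := fun i => by
      simpa [Algebra.smul_def] using he i
    rw [← Finset.sum_coe_sort S]
    have h3 : (((b : ℤ) * x j : ℤ) : ℚ) = ((∑ i, e i * a i j : ℤ) : ℚ) := by
      push_cast
      rw [← h1, Finset.mul_sum]
      exact Finset.sum_congr rfl fun i _ => by rw [h2, mul_assoc]
    have h4 : (b : ℤ) * x j = ∑ i, e i * a i j := by exact_mod_cast h3
    rw [h4]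
    exact Finset.sum_congr rfl fun i _ => by simp only [dif_pos i.2]
  · right
    obtain ⟨f, hfx, hf⟩ := Submodule.exists_le_ker_of_notMem hx
    obtain ⟨b, hb⟩ := IsLocalization.exist_integer_multiples_of_finite (nonZeroDivisors ℤ)
      (fun j : Fin d => f (Pi.single j 1))
    choose m hm using hb
    have hb0 : (((b : ℤ)) : ℚ) ≠ 0 := by exact_mod_cast nonZeroDivisors.ne_zero b.2
    have h2 : ∀ j, (m j : ℚ) = ((b : ℤ) : ℚ) * f (Pi.single j 1) := fun i => by
      simpa [Algebra.smul_def] using hm i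
    have key : ∀ y : Fin d → ℤ, ((∑ j, m j * y j : ℤ) : ℚ) =
        ((b : ℤ) : ℚ) * f (fun j => (y j : ℚ)) := by
      intro y
      rw [LinearMap.pi_apply_eq_sum_univ f, Finset.mul_sum]
      push_cast
      refine Finset.sum_congr rfl fun j _ => ?_
      rw [h2, smul_eq_mul]
      have : (fun i => if j = i then (1 : ℚ) else 0) = Pi.single j 1 := by
        ext i; simp [Pi.single_apply, eq_comm]
      rw [this]; ring
    refine ⟨m, fun i hi => ?_, fun h => ?_⟩
    · have h3 := key (a i)
      have h4 : f (fun j => (a i j : ℚ)) = 0 :=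
        hf (Submodule.subset_span ⟨i, hi, rfl⟩)
      rw [h4, mul_zero] at h3
      rw [pairing_apply]
      exact_mod_cast h3
    · have h3 := key x
      rw [h] at h3
      rw [Int.cast_zero] at h3
      exact (mul_ne_zero hb0 hfx) h3.symm

theorem pairing_eq_zero_of_combination (a : Fin n → Fin d → ℤ) (S : Finset (Fin n)) {K : Type*}
    [Field K] {i : Fin n} {M : ℤ} (hM : (M : K) ≠ 0) {c : Fin n → ℤ}
    (hc : ∀ j, M * a i j = ∑ k ∈ S, c k * a k j) {v : Fin d → K}
    (hv : ∀ k ∈ S, pairing a K k v = 0) : pairing a K i v = 0 := by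
  have : (M : K) * pairing a K i v = ∑ k ∈ S, (c k : K) * pairing a K k v := by
    simp only [pairing_apply, Finset.mul_sum]
    rw [Finset.sum_comm]
    refine Finset.sum_congr rfl fun j _ => ?_
    have h := congrArg (Int.cast : ℤ → K) (hc j)
    push_cast at h
    calc (M : K) * (v j * a i j) = v j * (M * a i j) := by ring
      _ = _ := by
        rw [h, Finset.mul_sum]
        exact Finset.sum_congr rfl fun k _ => by ring
  rw [Finset.sum_eq_zero fun k hk => by rw [hv k hk, mul_zero]] at this
  exact (mul_eq_zero.1 this).resolve_left hM

/-- Over fields of large characteristic, the intersections of hyperplanes have the same dimension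
as over `ℚ`. -/
theorem exists_card_inter (a : Fin n → Fin d → ℤ) (S : Finset (Fin n)) :
    ∃ e N : ℕ, ∀ (K : Type) [Field K] [Finite K], N < ringChar K →
      Nat.card {v : Fin d → K // ∀ i ∈ S, pairing a K i v = 0} = Nat.card K ^ e := by
  classical
  induction S using Finset.induction_on with
  | empty =>
    refine ⟨d, 0, fun K _ _ _ => ?_⟩
    have e : {v : Fin d → K // ∀ i ∈ (∅ : Finset (Fin n)), pairing a K i v = 0} ≃ (Fin d → K) :=
      Equiv.subtypeUnivEquiv (by simp)
    rw [Nat.card_congr e, Nat.card_fun, Nat.card_fin]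
  | insert i S hi ih =>
    obtain ⟨e, N, hN⟩ := ih
    rcases exists_combination_or_exists_orthogonal a S (a i) with
      ⟨M, hM, c, hc⟩ | ⟨m, hm, hm0⟩
    · refine ⟨e, max N M.natAbs, fun K _ _ hK => ?_⟩
      rw [← hN K (by omega)]
      refine Nat.card_congr (Equiv.subtypeEquivRight fun v => ?_)
      rw [Finset.forall_mem_insert, and_iff_right_iff_imp]
      intro hv
      have hMK : (M : K) ≠ 0 := intCast_ne_zero_of_lt_ringChar hM (by omega)
      exact pairing_eq_zero_of_combination a S hMK hc hv
    · have hpm : pairing a ℤ i m ≠ 0 := by simpa [pairing_apply] using hm0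
      refine ⟨e - 1, max N (pairing a ℤ i m).natAbs, fun K _ _ hK => ?_⟩
      have hK0 : (pairing a ℤ i m : K) ≠ 0 := intCast_ne_zero_of_lt_ringChar hpm (by omega)
      have hNK := hN K (by omega)
      have hq : 1 < Nat.card K := Finite.one_lt_card
      let mK : Fin d → K := fun j => (pairing a ℤ i m : K)⁻¹ * (m j : K)
      have hmK' : mK = (pairing a ℤ i m : K)⁻¹ • fun j => (m j : K) := rfl
      have hmi : pairing a K i mK = 1 := by
        rw [hmK', map_smul, pairing_intCast, smul_eq_mul, inv_mul_cancel₀ hK0]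
      have hmS : ∀ k ∈ S, pairing a K k mK = 0 := fun k hk => by
        rw [hmK', map_smul, pairing_intCast, hm k hk]; simp
      -- `mK` splits off a line from the intersection over `S`.
      let E : {v : Fin d → K // ∀ k ∈ S, pairing a K k v = 0} ≃
          {v : Fin d → K // ∀ k ∈ insert i S, pairing a K k v = 0} × K :=
        { toFun := fun v => (⟨v.1 - pairing a K i v.1 • mK, by
            intro k hk
            rw [map_sub, map_smul, smul_eq_mul]
            rcases Finset.mem_insert.1 hk with rfl | hk
            · rw [hmi, mul_one, sub_self]
            · rw [hmS k hk, v.2 k hk, mul_zero, sub_zero]⟩, pairing a K i v.1)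
          invFun := fun p => ⟨p.1.1 + p.2 • mK, by
            intro k hk
            rw [map_add, map_smul, hmS k hk, p.1.2 k (Finset.mem_insert_of_mem hk)]; simp⟩
          left_inv := fun v => by ext; simp
          right_inv := fun p => by
            have := p.1.2 i (Finset.mem_insert_self _ _)
            ext <;> simp [this, hmi] }
      rw [Nat.card_congr E, Nat.card_prod] at hNK
      rcases e with _ | e
      · rw [pow_zero] at hNK
        have := Nat.eq_one_of_mul_eq_one_left hNK
        omega
      · rw [pow_succ] at hNK
        exact Nat.eq_of_mul_eq_mul_right (by omega) hNK

/-- The locus where exactly the forms indexed by `F` vanish. -/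
def ExactZeroLocus (a : Fin n → Fin d → ℤ) (F : Finset (Fin n)) (K : Type) [Field K] : Type :=
  {v : Fin d → K // ∀ i, i ∈ F ↔ pairing a K i v = 0}

instance (a : Fin n → Fin d → ℤ) (F : Finset (Fin n)) (K : Type) [Field K] [Finite K] :
    Finite (ExactZeroLocus a F K) := by
  unfold ExactZeroLocus; infer_instance

/-- The intersection of the hyperplanes indexed by `F` is the disjoint union of the exact zero loci
of the sets containing `F`. -/
theorem card_inter_eq_sum (a : Fin n → Fin d → ℤ) (F : Finset (Fin n)) (K : Type) [Field K]
    [Finite K] :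
    Nat.card {v : Fin d → K // ∀ i ∈ F, pairing a K i v = 0} =
      ∑ G : Finset (Fin n) with F ⊆ G, Nat.card (ExactZeroLocus a G K) := by
  classical
  let E : {v : Fin d → K // ∀ i ∈ F, pairing a K i v = 0} ≃
      Σ G : {G : Finset (Fin n) // F ⊆ G}, ExactZeroLocus a G.1 K :=
    { toFun := fun v => ⟨⟨Finset.univ.filter fun i => pairing a K i v.1 = 0, fun i hi => by
        simpa using v.2 i hi⟩, ⟨v.1, by simp⟩⟩
      invFun := fun p => ⟨p.2.1, fun i hi => (p.2.2 i).1 (p.1.2 hi)⟩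
      left_inv := fun v => rfl
      right_inv := fun p => by
        obtain ⟨⟨G, hG⟩, v, hv⟩ := p
        have : G = Finset.univ.filter fun i => pairing a K i v = 0 := by
          ext i; simpa using hv i
        subst this
        rfl }
  rw [Nat.card_congr E, Nat.card_sigma]
  exact (Finset.sum_subtype (Finset.univ.filter (F ⊆ ·)) (by simp)
    (fun G => Nat.card (ExactZeroLocus a G K))).symm

theorem hasPolynomialPointCount_exactZeroLocus (a : Fin n → Fin d → ℤ) (F : Finset (Fin n)) :
    HasPolynomialPointCount (fun K _ => ExactZeroLocus a F K) := by
  classical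
  -- Induction from larger sets to smaller ones, by Möbius inversion of `card_inter_eq_sum`.
  refine Finset.strongDownwardInduction (n := n)
    (p := fun F => HasPolynomialPointCount (fun K _ => ExactZeroLocus a F K)) ?_ F
    (by simpa using Finset.card_le_univ F)
  intro F ih _
  have ih' : ∀ G : Finset (Fin n), ∃ ν : Polynomial ℤ, F ⊂ G →
      HasPointCount (fun K _ => ExactZeroLocus a G K) ν := by
    intro G
    by_cases hG : F ⊂ G
    · obtain ⟨ν, hν⟩ := ih (t₂ := G) (by simpa using Finset.card_le_univ G) hG
      exact ⟨ν, fun _ => hν⟩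
    · exact ⟨0, fun h => absurd h hG⟩
  choose ν hν using ih'
  have hN' : ∀ G : Finset (Fin n), ∃ N : ℕ, F ⊂ G → ∀ (K : Type) [Field K] [Finite K],
      N < ringChar K → Finite (ExactZeroLocus a G K) ∧
        (Nat.card (ExactZeroLocus a G K) : ℤ) = (ν G).eval (Nat.card K : ℤ) := by
    intro G
    by_cases hG : F ⊂ G
    · obtain ⟨N, hN⟩ := hν G hG
      exact ⟨N, fun _ => hN⟩
    · exact ⟨0, fun h => absurd h hG⟩
  choose N hN using hN'
  obtain ⟨e, M, hM⟩ := exists_card_inter a F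
  refine ⟨Polynomial.X ^ e - ∑ G : Finset (Fin n) with F ⊂ G, ν G,
    max M (Finset.univ.sup N), fun K _ _ hK => ⟨inferInstance, ?_⟩⟩
  have h1 := card_inter_eq_sum a F K
  rw [hM K (by omega)] at h1
  have h2 : (Finset.univ.filter fun G : Finset (Fin n) => F ⊆ G) =
      insert F (Finset.univ.filter fun G : Finset (Fin n) => F ⊂ G) := by
    ext G
    simp only [Finset.mem_filter, Finset.mem_univ, true_and, Finset.mem_insert]
    rw [show F ⊆ G ↔ F ⊂ G ∨ F = G from le_iff_lt_or_eq, or_comm, eq_comm]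
  rw [h2, Finset.sum_insert (by simp)] at h1
  have h3 : ∀ G ∈ Finset.univ.filter fun G : Finset (Fin n) => F ⊂ G,
      (Nat.card (ExactZeroLocus a G K) : ℤ) = (ν G).eval (Nat.card K : ℤ) := by
    intro G hG
    refine (hN G (by simpa using hG) K ?_).2
    have := Finset.le_sup (f := N) (Finset.mem_univ G)
    omega
  have h4 := congrArg (Nat.cast : ℕ → ℤ) h1
  push_cast at h4
  rw [Finset.sum_congr rfl h3] at h4
  simp only [Polynomial.eval_sub, Polynomial.eval_pow, Polynomial.eval_X,
    Polynomial.eval_finsetSum]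
  rw [h4, add_sub_cancel_right]

/-- The points of the complement of the restriction to `F` are the points where exactly the forms
indexed by `F` vanish. -/
def restrictionComplementEquiv (a : Fin n → Fin d → ℤ) (F : Finset (Fin n)) (K : Type)
    [Field K] : RestrictionComplement a F K ≃ ExactZeroLocus a F K where
  toFun x := ⟨x.1.1, fun i => ⟨mem_inter_hyperplane.1 x.1.2 i, fun h => by
    by_contra hi
    exact x.2 ⟨i, hi⟩ h⟩⟩
  invFun v := ⟨⟨v.1, mem_inter_hyperplane.2 fun i hi => (v.2 i).1 hi⟩, fun i h =>
    i.2 ((v.2 i.1).2 h)⟩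
  left_inv _ := rfl
  right_inv _ := rfl

theorem hasPointCount_restrictionComplement_iff (a : Fin n → Fin d → ℤ) (F : Finset (Fin n))
    (ν : Polynomial ℤ) : HasPointCount (fun K _ => RestrictionComplement a F K) ν ↔
      HasPointCount (fun K _ => ExactZeroLocus a F K) ν := by
  refine exists_congr fun N => forall_congr' fun K => forall_congr' fun _ => forall_congr' fun _ =>
    forall_congr' fun _ => ?_
  change Finite (RestrictionComplement a F K) ∧ (Nat.card (RestrictionComplement a F K) : ℤ) = _ ↔ _
  rw [(restrictionComplementEquiv a F K).finite_iff,
    Nat.card_congr (restrictionComplementEquiv a F K)]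

/-- Over a field of large characteristic, the set of forms vanishing at a point is a flat of the
real arrangement. -/
theorem exists_mem_flats_of_exactZeroLocus (a : Fin n → Fin d → ℤ) :
    ∃ N : ℕ, ∀ (K : Type) [Field K], N < ringChar K → ∀ (F : Finset (Fin n)) (v : Fin d → K),
      (∀ i, i ∈ F ↔ pairing a K i v = 0) → F ∈ flats a := by
  classical
  have h : ∀ p : Finset (Fin n) × Fin n, ∃ N : ℕ, p.2 ∉ p.1 →
      Arrangement.inter (hyperplane a ℝ) p.1 ≤ hyperplane a ℝ p.2 → ∀ (K : Type) [Field K],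
      N < ringChar K → ∀ v : Fin d → K, (∀ i ∈ p.1, pairing a K i v = 0) →
        pairing a K p.2 v = 0 := by
    rintro ⟨F, i⟩
    rcases exists_combination_or_exists_orthogonal a F (a i) with
      ⟨M, hM, c, hc⟩ | ⟨m, hm, hm0⟩
    · refine ⟨M.natAbs, fun _ _ K _ hK v hv => ?_⟩
      have hMK : (M : K) ≠ 0 := intCast_ne_zero_of_lt_ringChar hM hK
      exact pairing_eq_zero_of_combination a F hMK hc hv
    · refine ⟨0, fun _ hle => ?_⟩
      exfalso
      have h1 : (fun j => (m j : ℝ)) ∈ Arrangement.inter (hyperplane a ℝ) F :=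
        mem_inter_hyperplane.2 fun k hk => by rw [pairing_intCast, hm k hk, Int.cast_zero]
      have h2 := mem_hyperplane.1 (hle h1)
      rw [pairing_intCast] at h2
      refine hm0 ?_
      have h3 : pairing a ℤ i m = 0 := by exact_mod_cast h2
      simpa [pairing_apply] using h3
  choose N hN using h
  refine ⟨Finset.univ.sup N, fun K _ hK F v hv => ?_⟩
  simp only [flats, Finset.mem_filter, Finset.mem_univ, true_and]
  intro i
  refine ⟨fun hi => iInf₂_le (f := fun i (_ : i ∈ F) => hyperplane a ℝ i) i hi, fun hle => ?_⟩
  by_contra hi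
  refine hi ((hv i).2 (hN (F, i) hi hle K ?_ v fun k hk => (hv k).1 hk))
  have := Finset.le_sup (f := N) (Finset.mem_univ (F, i))
  omega

/-- Full rank: some nonzero multiple of the standard lattice lies in the span of the `a_i`. -/
theorem exists_combination_single (a : Fin n → Fin d → ℤ)
    (hrank : Module.finrank ℤ (Submodule.span ℤ (Set.range a)) = d) :
    ∃ N : ℤ, N ≠ 0 ∧ ∃ c : Fin d → Fin n → ℤ, ∀ j k,
      ∑ i, c j i * a i k = if k = j then N else 0 := by
  have hfin : Finite ((Fin d → ℤ) ⧸ Submodule.span ℤ (Set.range a)) := by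
    apply Submodule.finiteQuotientOfFreeOfRankEq
    simpa using hrank
  let N : ℤ := (Nat.card ((Fin d → ℤ) ⧸ Submodule.span ℤ (Set.range a)) : ℤ)
  have hN : N ≠ 0 := by
    have : 0 < Nat.card ((Fin d → ℤ) ⧸ Submodule.span ℤ (Set.range a)) := Nat.card_pos
    exact Int.natCast_ne_zero.2 this.ne'
  have hmem : ∀ x : Fin d → ℤ, N • x ∈ Submodule.span ℤ (Set.range a) := by
    intro x
    rw [← Submodule.Quotient.mk_eq_zero, Submodule.Quotient.mk_smul]
    simp only [N, Nat.cast_smul_eq_nsmul]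
    exact card_nsmul_eq_zero'
  have hc : ∀ j : Fin d, ∃ c : Fin n → ℤ, ∑ i, c i • a i = N • Pi.single j 1 := fun j =>
    (Submodule.mem_span_range_iff_exists_fun ℤ).1 (hmem _)
  choose c hc using hc
  refine ⟨N, hN, c, fun j k => ?_⟩
  have := congrFun (hc j) k
  simpa [Pi.single_apply] using this

theorem sum_mul_pairing (a : Fin n → Fin d → ℤ) {N : ℤ} {c : Fin d → Fin n → ℤ}
    (hc : ∀ j k, ∑ i, c j i * a i k = if k = j then N else 0) (R : Type*) [CommRing R]
    (v : Fin d → R) (j : Fin d) : ∑ i, (c j i : R) * pairing a R i v = N * v j := by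
  have hcR : ∀ k, ∑ i, (c j i : R) * (a i k : R) = if k = j then (N : R) else 0 := by
    intro k
    have := congrArg (Int.cast : ℤ → R) (hc j k)
    push_cast at this
    exact this
  simp only [pairing_apply, Finset.mul_sum]
  rw [Finset.sum_comm]
  have : ∀ k, ∑ i, (c j i : R) * (v k * (a i k : R)) = if k = j then N * v k else 0 := by
    intro k
    rw [← ite_zero_mul, ← hcR, Finset.sum_mul]
    exact Finset.sum_congr rfl fun i _ => by ring
  simp only [this, Finset.sum_ite_eq', Finset.mem_univ, if_true]

/-- A family `η` that satisfies the moment map equations comes from a unique vector `v`. -/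
theorem exists_pairing_eq (a : Fin n → Fin d → ℤ)
    (hrank : Module.finrank ℤ (Submodule.span ℤ (Set.range a)) = d) :
    ∃ N : ℕ, ∀ (K : Type) [Field K], N < ringChar K → ∀ η : Fin n → K,
      (∀ b ∈ lieKernel a, ∑ i, (b i : K) * η i = 0) →
      ∃! v : Fin d → K, ∀ i, pairing a K i v = η i := by
  obtain ⟨N, hN, c, hc⟩ := exists_combination_single a hrank
  refine ⟨N.natAbs, fun K _ hK η hη => ?_⟩
  have hNK : (N : K) ≠ 0 := intCast_ne_zero_of_lt_ringChar hN hK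
  have hv := sum_mul_pairing a hc K
  refine ⟨fun j => (N : K)⁻¹ * ∑ i, (c j i : K) * η i, fun l => ?_, fun v' hv' => ?_⟩
  · have hb := hη (fun i => (if i = l then N else 0) - ∑ j, a l j * c j i) (by
      rw [lieKernel, LinearMap.mem_ker, Fintype.linearCombination_apply]
      ext k
      simp only [Finset.sum_apply, Pi.smul_apply, smul_eq_mul, sub_mul, Finset.sum_sub_distrib,
        Pi.zero_apply, ite_mul, zero_mul, Finset.sum_ite_eq', Finset.mem_univ, if_true,
        Finset.sum_mul]
      rw [Finset.sum_comm]
      have : ∀ j, ∑ i, a l j * c j i * a i k = if k = j then N * a l j else 0 := by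
        intro j
        rw [← ite_zero_mul, ← hc, Finset.sum_mul]
        exact Finset.sum_congr rfl fun i _ => by ring
      simp only [this, Finset.sum_ite_eq, Finset.mem_univ, if_true, sub_self])
    simp only [Int.cast_sub, Int.cast_sum, Int.cast_mul, Int.cast_ite, Int.cast_zero, sub_mul,
      Finset.sum_sub_distrib, ite_mul, zero_mul, Finset.sum_ite_eq', Finset.mem_univ,
      if_true, Finset.sum_mul] at hb
    rw [Finset.sum_comm, sub_eq_zero] at hb
    rw [pairing_apply]
    apply mul_left_cancel₀ hNK
    rw [hb, Finset.mul_sum]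
    refine Finset.sum_congr rfl fun j _ => ?_
    calc (N : K) * ((N : K)⁻¹ * (∑ i, (c j i : K) * η i) * (a l j : K))
        = (∑ i, (c j i : K) * η i) * (a l j : K) := by field_simp
      _ = _ := by
        rw [Finset.sum_mul]
        exact Finset.sum_congr rfl fun i _ => by ring
  · funext j
    have := hv v' j
    simp only [hv'] at this
    rw [this, inv_mul_cancel_left₀ hNK]

theorem eq_of_pairing_eq (a : Fin n → Fin d → ℤ)
    (hrank : Module.finrank ℤ (Submodule.span ℤ (Set.range a)) = d) {m m' : Fin d → ℤ}
    (h : ∀ i, pairing a ℤ i m = pairing a ℤ i m') : m = m' := by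
  obtain ⟨N, hN, c, hc⟩ := exists_combination_single a hrank
  have hv := sum_mul_pairing a hc ℤ
  funext j
  refine mul_left_cancel₀ hN ?_
  have h1 := hv m j
  simp only [h, hv] at h1
  simpa using h1.symm

end Hypertoric

/-! ### Chambers of a localization -/

namespace Hypertoric

variable {d n : ℕ}

/-- A chamber of the localization at `F`, encoded by the signs of the linear forms indexed by `F`
on it. As the cones are rational, it suffices to consider the signs at lattice points. -/
def Chamber (a : Fin n → Fin d → ℤ) (F : Finset (Fin n)) : Type :=
  {σ : {i // i ∈ F} → SignType //
    ∃ m : Fin d → ℤ, ∀ i : {i // i ∈ F},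
      pairing a ℤ i m ≠ 0 ∧ σ i = SignType.sign (pairing a ℤ i m)}

instance (a : Fin n → Fin d → ℤ) (F : Finset (Fin n)) : Finite (Chamber a F) := by
  unfold Chamber; infer_instance

theorem sign_eq_of_mul_pos {R : Type*} [Ring R] [LinearOrder R] [IsStrictOrderedRing R] {x y : R}
    (h : 0 < x * y) : SignType.sign x = SignType.sign y := by
  rcases pos_and_pos_or_neg_and_neg_of_mul_pos h with ⟨hx, hy⟩ | ⟨hx, hy⟩
  · rw [sign_pos hx, sign_pos hy]
  · rw [sign_neg hx, sign_neg hy]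

/-- Every chamber of the real arrangement contains a lattice point. -/
theorem exists_lattice_point_sign_eq (a : Fin n → Fin d → ℤ) (F : Finset (Fin n))
    (v : Fin d → ℝ) (hv : ∀ i ∈ F, pairing a ℝ i v ≠ 0) :
    ∃ m : Fin d → ℤ, ∀ i ∈ F, pairing a ℤ i m ≠ 0 ∧
      SignType.sign (pairing a ℝ i v) = SignType.sign (pairing a ℤ i m) := by
  have hopen : IsOpen {u : Fin d → ℝ | ∀ i ∈ F, 0 < pairing a ℝ i v * pairing a ℝ i u} := by
    have h : {u : Fin d → ℝ | ∀ i ∈ F, 0 < pairing a ℝ i v * pairing a ℝ i u} =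
        ⋂ i ∈ F, {u | 0 < pairing a ℝ i v * pairing a ℝ i u} := by ext; simp
    rw [h]
    refine isOpen_biInter_finset fun i _ => isOpen_lt continuous_const ?_
    exact continuous_const.mul (LinearMap.continuous_of_finiteDimensional _)
  have hdense : DenseRange (fun (q : Fin d → ℚ) (j : Fin d) => (q j : ℝ)) :=
    DenseRange.piMap fun _ => Rat.denseRange_cast
  obtain ⟨q, hq⟩ := hdense.exists_mem_open hopen
    ⟨v, fun i hi => mul_self_pos.2 (hv i hi)⟩
  obtain ⟨b, hb⟩ := IsLocalization.exist_integer_multiples_of_finite (nonZeroDivisors ℤ) q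
  choose e he using hb
  have hb0 : (b : ℤ) ≠ 0 := nonZeroDivisors.ne_zero b.2
  have he' : ∀ j, (e j : ℝ) = ((b : ℤ) : ℝ) * (q j : ℝ) := fun j => by
    have h : (e j : ℚ) = ((b : ℤ) : ℚ) * q j := by simpa [Algebra.smul_def] using he j
    exact_mod_cast congrArg (Rat.cast : ℚ → ℝ) h
  -- The factor `b ^ 2` clears denominators and is positive.
  have key : ∀ i, (pairing a ℤ i ((b : ℤ) • e) : ℝ) =
      ((b : ℤ) : ℝ) ^ 2 * pairing a ℝ i (fun j => (q j : ℝ)) := by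
    intro i
    rw [← pairing_intCast, ← smul_eq_mul, ← map_smul]
    congr 1
    funext j
    simp [he']
    ring
  refine ⟨(b : ℤ) • e, fun i hi => ?_⟩
  have hbpos : (0 : ℝ) < ((b : ℤ) : ℝ) ^ 2 := by
    have : ((b : ℤ) : ℝ) ≠ 0 := by exact_mod_cast hb0
    positivity
  have hpos : 0 < pairing a ℝ i v * (pairing a ℤ i ((b : ℤ) • e) : ℝ) := by
    rw [key]
    have := mul_pos hbpos (hq i hi)
    linarith
  refine ⟨fun h => ?_, ?_⟩
  · rw [h] at hpos
    simp at hpos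
  · rw [sign_eq_of_mul_pos hpos, sign_intCast]

variable (a : Fin n → Fin d → ℤ) (F : Finset (Fin n))

/-- The linear form induced by `v ↦ v · a_i` on the quotient by `H_F`, for `i ∈ F`. -/
def localForm (i : {i // i ∈ F}) :
    ((Fin d → ℝ) ⧸ Arrangement.inter (hyperplane a ℝ) F) →ₗ[ℝ] ℝ :=
  (Arrangement.inter (hyperplane a ℝ) F).liftQ (pairing a ℝ i)
    (fun _ hv => mem_inter_hyperplane.1 hv i.1 i.2)

theorem localForm_mkQ (i : {i // i ∈ F}) (v : Fin d → ℝ) :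
    localForm a F i ((Arrangement.inter (hyperplane a ℝ) F).mkQ v) = pairing a ℝ i v :=
  rfl

theorem continuous_localForm (i : {i // i ∈ F}) : Continuous (localForm a F i) :=
  (Submodule.isQuotientMap_mkQ _).continuous_iff.2
    (LinearMap.continuous_of_finiteDimensional (pairing a ℝ i))

theorem mem_localization_iff (i : {i // i ∈ F})
    (w : (Fin d → ℝ) ⧸ Arrangement.inter (hyperplane a ℝ) F) :
    w ∈ Arrangement.localization (hyperplane a ℝ) F i ↔ localForm a F i w = 0 := by
  obtain ⟨v, rfl⟩ := Submodule.mkQ_surjective _ w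
  rw [localForm_mkQ, Arrangement.localization, Submodule.mem_map]
  constructor
  · rintro ⟨u, hu, huv⟩
    rw [← localForm_mkQ, ← huv, localForm_mkQ]
    exact hu
  · exact fun h => ⟨v, h, rfl⟩

/-- The sign vector of a point of the complement of the localization. -/
def complementSign (x : Arrangement.complement (Arrangement.localization (hyperplane a ℝ) F))
    (i : {i // i ∈ F}) : SignType :=
  SignType.sign (localForm a F i x.1)

theorem localForm_ne_zero
    (x : Arrangement.complement (Arrangement.localization (hyperplane a ℝ) F))
    (i : {i // i ∈ F}) : localForm a F i x.1 ≠ 0 := fun h =>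
  x.2 i ((mem_localization_iff a F i x.1).2 h)

theorem continuous_complementSign : Continuous (complementSign a F) := by
  refine continuous_pi fun i => continuous_iff_continuousAt.2 fun x => ?_
  have h : ContinuousAt (fun y : Arrangement.complement (Arrangement.localization
      (hyperplane a ℝ) F) => localForm a F i y.1) x :=
    ((continuous_localForm a F i).comp continuous_subtype_val).continuousAt
  exact ContinuousAt.comp (f := fun y : Arrangement.complement (Arrangement.localization
    (hyperplane a ℝ) F) => localForm a F i y.1)
    (continuousAt_sign_of_ne_zero (localForm_ne_zero a F x i)) h

/-- The points with a given sign vector form a convex, hence connected, set. -/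
theorem isPreconnected_fiber_complementSign (σ : {i // i ∈ F} → SignType) :
    IsPreconnected (complementSign a F ⁻¹' {σ}) := by
  refine Topology.IsInducing.subtypeVal.isPreconnected_image.1 ?_
  have h : Subtype.val '' (complementSign a F ⁻¹' {σ}) =
      {w | ∀ i, 0 < (σ i : ℝ) * localForm a F i w} := by
    ext w
    constructor
    · rintro ⟨x, rfl, rfl⟩ i
      rw [complementSign, sign_mul_self]
      exact abs_pos.2 (localForm_ne_zero a F x i)
    · intro hw
      have hne : ∀ i, localForm a F i w ≠ 0 := fun i h => by simpa [h] using hw i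
      refine ⟨⟨w, fun i hi => hne i ((mem_localization_iff a F i w).1 hi)⟩, ?_, rfl⟩
      funext i
      change SignType.sign (localForm a F i w) = σ i
      rw [← sign_eq_of_mul_pos (hw i)]
      cases σ i <;> simp
  rw [h]
  refine Convex.isPreconnected ?_
  have h2 : {w | ∀ i, 0 < (σ i : ℝ) * localForm a F i w} =
      ⋂ i, {w | 0 < ((σ i : ℝ) • localForm a F i) w} := by ext; simp
  rw [h2]
  exact convex_iInter fun i => convex_halfSpace_gt (LinearMap.isLinear _) 0

/-- The connected components of the complement of the localization are its chambers. -/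
theorem localizationRegions_eq_card_chamber :
    localizationRegions a F = Nat.card (Chamber a F) := by
  have hsign : ∀ x, ∃ m : Fin d → ℤ, ∀ i : {i // i ∈ F}, pairing a ℤ i m ≠ 0 ∧
      complementSign a F x i = SignType.sign (pairing a ℤ i m) := by
    intro x
    obtain ⟨v, hv⟩ := Submodule.mkQ_surjective _ x.1
    have hvx : ∀ i : {i // i ∈ F}, localForm a F i x.1 = pairing a ℝ i v := fun i => by
      rw [← hv, localForm_mkQ]
    obtain ⟨m, hm⟩ := exists_lattice_point_sign_eq a F v fun i hi => by
      rw [← hvx ⟨i, hi⟩]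
      exact localForm_ne_zero a F x ⟨i, hi⟩
    refine ⟨m, fun i => ⟨(hm i i.2).1, ?_⟩⟩
    rw [complementSign, hvx]
    exact (hm i i.2).2
  refine Nat.card_eq_of_bijective
    (fun c => (⟨(continuous_complementSign a F).connectedComponentsLift c, by
      obtain ⟨x, rfl⟩ := ConnectedComponents.surjective_coe c
      exact hsign x⟩ : Chamber a F)) ⟨?_, ?_⟩
  · intro c c' h
    obtain ⟨x, rfl⟩ := ConnectedComponents.surjective_coe c
    obtain ⟨y, rfl⟩ := ConnectedComponents.surjective_coe c'
    have hxy : complementSign a F x = complementSign a F y := congrArg Subtype.val h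
    rw [ConnectedComponents.coe_eq_coe']
    exact (isPreconnected_fiber_complementSign a F (complementSign a F y)).subset_connectedComponent
      rfl hxy
  · rintro ⟨σ, m, hm⟩
    have hl : ∀ i : {i // i ∈ F}, localForm a F i
        ((Arrangement.inter (hyperplane a ℝ) F).mkQ fun j => (m j : ℝ)) = pairing a ℤ i m :=
      fun i => by rw [localForm_mkQ, pairing_intCast]
    refine ⟨ConnectedComponents.mk ⟨(Arrangement.inter (hyperplane a ℝ) F).mkQ fun j => (m j : ℝ),
      fun i hi => ?_⟩, Subtype.ext ?_⟩
    · rw [mem_localization_iff, hl] at hi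
      exact (hm i).1 (by exact_mod_cast hi)
    · funext i
      change SignType.sign (localForm a F i _) = σ i
      rw [hl, sign_intCast, (hm i).2]

end Hypertoric

/-! ### The ring of invariants -/

namespace Hypertoric

variable {d n : ℕ} (a : Fin n → Fin d → ℤ)

/-- The image of the monomial `z ^ α * w ^ β` in the coordinate ring of `μ⁻¹(0)`. -/
def zwMonomial (α β : Fin n → ℕ) : ZeroFiberRing a := ∏ i, zCoord a i ^ α i * wCoord a i ^ β i

theorem mk_monomial (u : (Fin n ⊕ Fin n) →₀ ℕ) (c : ℤ) :
    Ideal.Quotient.mk (momentIdeal a) (MvPolynomial.monomial u c) =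
      c • zwMonomial a (fun i => u (Sum.inl i)) (fun i => u (Sum.inr i)) := by
  rw [MvPolynomial.monomial_eq, Finsupp.prod_fintype _ _ (by simp), Fintype.prod_sum_type,
    ← Finset.prod_mul_distrib, map_mul, map_prod, zsmul_eq_mul]
  congr 1

theorem zeroFiberRing_induction {P : ZeroFiberRing a → Prop}
    (monomial : ∀ (c : ℤ) α β, P (c • zwMonomial a α β))
    (add : ∀ x y, P x → P y → P (x + y)) (s : ZeroFiberRing a) : P s := by
  obtain ⟨f, rfl⟩ := Ideal.Quotient.mk_surjective s
  induction f using MvPolynomial.induction_on' with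
  | monomial u c => rw [mk_monomial]; exact monomial _ _ _
  | add p q hp hq => rw [map_add]; exact add _ _ hp hq

theorem zwMonomial_mul (α β α' β' : Fin n → ℕ) :
    zwMonomial a α β * zwMonomial a α' β' = zwMonomial a (α + α') (β + β') := by
  rw [zwMonomial, zwMonomial, zwMonomial, ← Finset.prod_mul_distrib]
  refine Finset.prod_congr rfl fun i _ => ?_
  rw [Pi.add_apply, Pi.add_apply, pow_add, pow_add]
  ring

theorem coaction_zCoord (i : Fin n) :
    coaction a (zCoord a i) = AddMonoidAlgebra.single (character a i) (zCoord a i) := by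
  simp [coaction, coactionLift, zCoord]

theorem coaction_wCoord (i : Fin n) :
    coaction a (wCoord a i) = AddMonoidAlgebra.single (-character a i) (wCoord a i) := by
  simp [coaction, coactionLift, wCoord]

theorem coaction_zwMonomial (α β : Fin n → ℕ) :
    coaction a (zwMonomial a α β) = AddMonoidAlgebra.single
      ((trivialCharacters a).mkQ fun i => (α i : ℤ) - β i) (zwMonomial a α β) := by
  classical
  have h : ∀ s : Finset (Fin n), coaction a (∏ i ∈ s, zCoord a i ^ α i * wCoord a i ^ β i) =
      AddMonoidAlgebra.single (∑ i ∈ s, ((α i : ℤ) - β i) • character a i)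
        (∏ i ∈ s, zCoord a i ^ α i * wCoord a i ^ β i) := by
    intro s
    induction s using Finset.induction_on with
    | empty => simp [AddMonoidAlgebra.one_def]
    | insert i s hi ih =>
      rw [Finset.prod_insert hi, Finset.sum_insert hi, map_mul, ih, map_mul, map_pow, map_pow,
        coaction_zCoord, coaction_wCoord, AddMonoidAlgebra.single_pow, AddMonoidAlgebra.single_pow,
        AddMonoidAlgebra.single_mul_single, AddMonoidAlgebra.single_mul_single]
      congr 2
      rw [sub_smul, natCast_zsmul, natCast_zsmul, smul_neg, sub_eq_add_neg]
  rw [zwMonomial, h]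
  congr 1
  simp only [character, ← map_zsmul, ← map_sum]
  congr 1
  ext j
  simp [Finset.sum_apply, Pi.single_apply]

theorem mem_trivialCharacters_iff (l : Fin n → ℤ) :
    l ∈ trivialCharacters a ↔ ∃ m : Fin d → ℤ, ∀ i, pairing a ℤ i m = l i := by
  rw [trivialCharacters, LinearMap.mem_range]
  refine exists_congr fun m => ?_
  rw [funext_iff]
  refine forall_congr' fun i => ?_
  simp [pairing_apply, Matrix.mulVec, dotProduct, mul_comm]

theorem zwMonomial_mem_invariantRing {α β : Fin n → ℕ}
    (h : ∃ m : Fin d → ℤ, ∀ i, pairing a ℤ i m = (α i : ℤ) - β i) :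
    zwMonomial a α β ∈ invariantRing a := by
  change coaction a _ = AddMonoidAlgebra.single 0 _
  rw [coaction_zwMonomial]
  congr 1
  rw [Submodule.mkQ_apply, Submodule.Quotient.mk_eq_zero]
  exact (mem_trivialCharacters_iff a _).2 h

theorem invariantPart_zwMonomial_of_not {α β : Fin n → ℕ} (c : ℤ)
    (h : ¬ ∃ m : Fin d → ℤ, ∀ i, pairing a ℤ i m = (α i : ℤ) - β i) :
    invariantPart a (c • zwMonomial a α β) = 0 := by
  rw [map_zsmul]
  have : invariantPart a (zwMonomial a α β) = 0 := by
    change (coaction a _).coeff 0 = 0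
    rw [coaction_zwMonomial]
    rw [← mem_trivialCharacters_iff] at h
    have h0 : (trivialCharacters a).mkQ (fun i => (α i : ℤ) - β i) ≠ 0 := by
      rwa [Submodule.mkQ_apply, Ne, Submodule.Quotient.mk_eq_zero]
    rw [AddMonoidAlgebra.coeff_single, Finsupp.single_eq_of_ne h0.symm]
  rw [this, smul_zero]

/-- The invariant function `z_i w_i`. -/
def hFun (i : Fin n) : invariantRing a :=
  ⟨zCoord a i * wCoord a i, by
    change coaction a _ = AddMonoidAlgebra.single 0 _
    rw [map_mul, coaction_zCoord, coaction_wCoord, AddMonoidAlgebra.single_mul_single,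
      add_neg_cancel]⟩

/-- The invariant function attached to a character `m` of `T^d`: the monomial of weight
`(m · a_i)_i` that is not divisible by any `z_i w_i`. -/
def xFun (m : Fin d → ℤ) : invariantRing a :=
  ⟨zwMonomial a (fun i => (pairing a ℤ i m).toNat) (fun i => (-pairing a ℤ i m).toNat),
    zwMonomial_mem_invariantRing a ⟨m, fun i => by omega⟩⟩

/-- The exponent of `z_i w_i` that splits off from the product of two monomials of weights `s` and
`t` in the `i`-th variables. It vanishes if and only if `s` and `t` do not have opposite signs. -/
def overlap (s t : ℤ) : ℕ := min (s.toNat + t.toNat) ((-s).toNat + (-t).toNat)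

theorem coe_prod_hFun (γ : Fin n → ℕ) :
    ((∏ i, hFun a i ^ γ i : invariantRing a) : ZeroFiberRing a) = zwMonomial a γ γ := by
  rw [zwMonomial, SubmonoidClass.coe_finsetProd]
  refine Finset.prod_congr rfl fun i _ => ?_
  rw [SubmonoidClass.coe_pow, hFun, mul_pow]

theorem coe_prod_hFun_mul_xFun (γ : Fin n → ℕ) (m : Fin d → ℤ) :
    (((∏ i, hFun a i ^ γ i) * xFun a m : invariantRing a) : ZeroFiberRing a) =
      zwMonomial a (fun i => γ i + (pairing a ℤ i m).toNat)
        (fun i => γ i + (-pairing a ℤ i m).toNat) := by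
  rw [MulMemClass.coe_mul, coe_prod_hFun, xFun, zwMonomial_mul]
  rfl

theorem xFun_zero : xFun a 0 = 1 := Subtype.ext (by simp [xFun, zwMonomial])

theorem xFun_mul_xFun (m m' : Fin d → ℤ) : xFun a m * xFun a m' =
    (∏ i, hFun a i ^ overlap (pairing a ℤ i m) (pairing a ℤ i m')) * xFun a (m + m') := by
  apply Subtype.ext
  rw [coe_prod_hFun_mul_xFun, MulMemClass.coe_mul, xFun, xFun, zwMonomial_mul]
  congr 1 <;> funext i <;> simp only [Pi.add_apply, map_add, overlap] <;> omega

theorem zwMonomial_eq_prod_hFun_mul_xFun {α β : Fin n → ℕ} {m : Fin d → ℤ}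
    (h : ∀ i, pairing a ℤ i m = (α i : ℤ) - β i) : zwMonomial a α β =
      ((∏ i, hFun a i ^ min (α i) (β i)) * xFun a m : invariantRing a) := by
  rw [coe_prod_hFun_mul_xFun]
  congr 1 <;> funext i <;> rw [h] <;> omega

theorem sum_smul_hFun {b : Fin n → ℤ} (hb : b ∈ lieKernel a) : ∑ i, b i • hFun a i = 0 := by
  apply Subtype.ext
  have h : Ideal.Quotient.mk (momentIdeal a) (momentComponent b) = 0 :=
    Ideal.Quotient.eq_zero_iff_mem.2 (Ideal.subset_span ⟨b, hb, rfl⟩)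
  rw [momentComponent, map_sum] at h
  rw [AddSubmonoidClass.coe_finsetSum, ZeroMemClass.coe_zero, ← h]
  refine Finset.sum_congr rfl fun i _ => ?_
  simp [hFun, zCoord, wCoord]

/-- The invariant ring is spanned by the products of the functions `z_i w_i` with the monomials
`xFun a m`. -/
theorem closure_range_prod_hFun_mul_xFun :
    AddSubgroup.closure (Set.range fun p : (Fin n → ℕ) × (Fin d → ℤ) =>
      (∏ i, hFun a i ^ p.1 i) * xFun a p.2) = ⊤ := by
  rw [eq_top_iff]
  intro r _
  have key : ∀ s : ZeroFiberRing a, (⟨invariantPart a s, invariantPart_mem a s⟩ : invariantRing a) ∈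
      AddSubgroup.closure (Set.range fun p : (Fin n → ℕ) × (Fin d → ℤ) =>
        (∏ i, hFun a i ^ p.1 i) * xFun a p.2) := by
    intro s
    induction s using zeroFiberRing_induction with
    | monomial c α β =>
      by_cases h : ∃ m : Fin d → ℤ, ∀ i, pairing a ℤ i m = (α i : ℤ) - β i
      · obtain ⟨m, hm⟩ := h
        have hinv := zwMonomial_mem_invariantRing a ⟨m, hm⟩
        have : (⟨invariantPart a (c • zwMonomial a α β), invariantPart_mem a _⟩ :
            invariantRing a) = c • ((∏ i, hFun a i ^ min (α i) (β i)) * xFun a m) := by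
          apply Subtype.ext
          change invariantPart a _ = _
          rw [map_zsmul, invariantPart_of_mem a _ hinv, zwMonomial_eq_prod_hFun_mul_xFun a hm]
          rfl
        rw [this]
        refine zsmul_mem (AddSubgroup.subset_closure ?_) c
        exact ⟨(fun i => min (α i) (β i), m), rfl⟩
      · have : (⟨invariantPart a (c • zwMonomial a α β), invariantPart_mem a _⟩ :
            invariantRing a) = 0 := Subtype.ext (invariantPart_zwMonomial_of_not a c h)
        rw [this]
        exact zero_mem _
    | add x y hx hy =>
      have := add_mem hx hy
      convert this using 1
      apply Subtype.ext
      exact map_add (invariantPart a) x y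
  have h := key r
  have hr : (⟨invariantPart a r, invariantPart_mem a r⟩ : invariantRing a) = r :=
    Subtype.ext (invariantPart_of_mem a _ r.2)
  rwa [hr] at h

theorem ringHom_ext_of_hFun_xFun {K : Type*} [CommRing K] {φ ψ : invariantRing a →+* K}
    (hh : ∀ i, φ (hFun a i) = ψ (hFun a i)) (hx : ∀ m, φ (xFun a m) = ψ (xFun a m)) : φ = ψ := by
  have h : φ.toAddMonoidHom = ψ.toAddMonoidHom := by
    refine AddMonoidHom.eq_of_eqOn_dense (closure_range_prod_hFun_mul_xFun a) ?_
    rintro _ ⟨p, rfl⟩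
    change φ _ = ψ _
    simp [map_mul, map_prod, map_pow, hh, hx]
  exact RingHom.ext fun r => DFunLike.congr_fun h r

/-! ### Homomorphisms from the ring of invariants to a field -/

section Homomorphisms

variable {K : Type*} [Field K]

/-- The relations satisfied by the values `η i` of the functions `z_i w_i` and `g m` of the
functions `xFun a m` under a ring homomorphism. -/
structure IsTwistedCharacter (η : Fin n → K) (g : (Fin d → ℤ) → K) : Prop where
  map_zero : g 0 = 1
  map_mul : ∀ m m', g m * g m' =
    (∏ i, η i ^ overlap (pairing a ℤ i m) (pairing a ℤ i m')) * g (m + m')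

/-- The value on monomials of the additive extension to the polynomial ring of a twisted character;
it vanishes on the monomials that are not invariant. -/
def monomialValue (η : Fin n → K) (g : (Fin d → ℤ) → K) (u : (Fin n ⊕ Fin n) →₀ ℕ) : K :=
  (∏ i, η i ^ min (u (Sum.inl i)) (u (Sum.inr i))) *
    Function.extend (fun m i => pairing a ℤ i m) g 0
      (fun i => (u (Sum.inl i) : ℤ) - u (Sum.inr i))

/-- The additive extension of a twisted character to the polynomial ring. -/
def polynomialValue (η : Fin n → K) (g : (Fin d → ℤ) → K) : CotangentRing n →+ K :=
  ((MvPolynomial.basisMonomials (Fin n ⊕ Fin n) ℤ).constr ℤ (monomialValue a η g)).toAddMonoidHom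

theorem polynomialValue_monomial (η : Fin n → K) (g : (Fin d → ℤ) → K)
    (u : (Fin n ⊕ Fin n) →₀ ℕ) (c : ℤ) :
    polynomialValue a η g (MvPolynomial.monomial u c) = c • monomialValue a η g u := by
  have h1 : polynomialValue a η g (MvPolynomial.monomial u 1) = monomialValue a η g u := by
    have := (MvPolynomial.basisMonomials (Fin n ⊕ Fin n) ℤ).constr_basis ℤ (monomialValue a η g) u
    rwa [MvPolynomial.coe_basisMonomials] at this
  have h2 : MvPolynomial.monomial u c = c • (MvPolynomial.monomial u 1 : CotangentRing n) := by
    rw [MvPolynomial.smul_monomial]; simp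
  rw [h2, map_zsmul, h1]

theorem monomialValue_add_single (η : Fin n → K) (g : (Fin d → ℤ) → K)
    (u : (Fin n ⊕ Fin n) →₀ ℕ) (i : Fin n) :
    monomialValue a η g (u + Finsupp.single (Sum.inl i) 1 + Finsupp.single (Sum.inr i) 1) =
      η i * monomialValue a η g u := by
  classical
  rw [monomialValue, monomialValue, ← mul_assoc]
  congr 1
  · rw [← Finset.mul_prod_erase _ _ (Finset.mem_univ i),
      ← Finset.mul_prod_erase _ (fun i => η i ^ min (u (Sum.inl i)) (u (Sum.inr i)))
        (Finset.mem_univ i), ← mul_assoc, ← pow_succ']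
    congr 1
    · simp
    · refine Finset.prod_congr rfl fun j hj => ?_
      have hij : i ≠ j := (Finset.ne_of_mem_erase hj).symm
      simp [hij]
  · congr 1
    funext j
    rcases eq_or_ne i j with rfl | hij
    · simp
    · simp [hij]

theorem polynomialValue_eq_zero {η : Fin n → K} (g : (Fin d → ℤ) → K)
    (hη : ∀ b ∈ lieKernel a, ∑ i, (b i : K) * η i = 0) {p : CotangentRing n}
    (hp : p ∈ momentIdeal a) : polynomialValue a η g p = 0 := by
  have key : ∀ q : CotangentRing n, polynomialValue a η g (q * p) = 0 := by
    induction hp using Submodule.span_induction with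
    | mem x hx =>
      obtain ⟨b, hb, rfl⟩ := hx
      intro q
      induction q using MvPolynomial.induction_on' with
      | monomial u c =>
        have h : ∀ i, MvPolynomial.monomial u c * (MvPolynomial.C (b i) *
            (MvPolynomial.X (Sum.inl i) * MvPolynomial.X (Sum.inr i))) =
            MvPolynomial.monomial
              (u + Finsupp.single (Sum.inl i) 1 + Finsupp.single (Sum.inr i) 1) (c * b i) := by
          intro i
          rw [MvPolynomial.C_apply, MvPolynomial.X, MvPolynomial.X, MvPolynomial.monomial_mul,
            MvPolynomial.monomial_mul, MvPolynomial.monomial_mul]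
          congr 1
          · rw [zero_add, add_assoc]
          · ring
        rw [momentComponent, Finset.mul_sum, map_sum]
        simp only [h, polynomialValue_monomial, monomialValue_add_single]
        have h2 : ∀ i, (c * b i) • (η i * monomialValue a η g u) =
            ((b i : K) * η i) * (c * monomialValue a η g u) := by
          intro i; rw [zsmul_eq_mul]; push_cast; ring
        simp only [h2]
        rw [← Finset.sum_mul, hη b hb, zero_mul]
      | add q r hq hr => rw [add_mul, map_add, hq, hr, add_zero]
    | zero => intro q; rw [mul_zero, map_zero]
    | add x y _ _ hx hy => intro q; rw [mul_add, map_add, hx, hy, add_zero]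
    | smul c x _ hx => intro q; rw [smul_eq_mul, ← mul_assoc, hx]
  simpa using key 1

/-- The additive extension of a twisted character to the coordinate ring of `μ⁻¹(0)`. -/
def fiberValue (η : Fin n → K) (g : (Fin d → ℤ) → K)
    (hη : ∀ b ∈ lieKernel a, ∑ i, (b i : K) * η i = 0) : ZeroFiberRing a →+ K :=
  (Ideal.Quotient.mk (momentIdeal a)).toAddMonoidHom.liftOfSurjective
    Ideal.Quotient.mk_surjective ⟨polynomialValue a η g, fun _ hp =>
      polynomialValue_eq_zero a g hη (Ideal.Quotient.eq_zero_iff_mem.1 hp)⟩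

theorem fiberValue_mk (η : Fin n → K) (g : (Fin d → ℤ) → K)
    (hη : ∀ b ∈ lieKernel a, ∑ i, (b i : K) * η i = 0) (p : CotangentRing n) :
    fiberValue a η g hη (Ideal.Quotient.mk _ p) = polynomialValue a η g p :=
  AddMonoidHom.liftOfRightInverse_comp_apply _ _ _ _ p

theorem fiberValue_prod_hFun_mul_xFun
    (hinj : Function.Injective fun (m : Fin d → ℤ) i => pairing a ℤ i m)
    (η : Fin n → K) (g : (Fin d → ℤ) → K)
    (hη : ∀ b ∈ lieKernel a, ∑ i, (b i : K) * η i = 0) (γ : Fin n → ℕ) (m : Fin d → ℤ) :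
    fiberValue a η g hη ((∏ i, hFun a i ^ γ i) * xFun a m : invariantRing a) =
      (∏ i, η i ^ γ i) * g m := by
  have h := mk_monomial a (Finsupp.equivFunOnFinite.symm (Sum.elim
    (fun i => γ i + (pairing a ℤ i m).toNat) (fun i => γ i + (-pairing a ℤ i m).toNat))) 1
  rw [one_smul] at h
  rw [coe_prod_hFun_mul_xFun]
  refine (congrArg _ h.symm).trans ?_
  rw [fiberValue_mk, polynomialValue_monomial, one_smul, monomialValue]
  simp only [Finsupp.equivFunOnFinite_symm_apply_apply, Sum.elim_inl, Sum.elim_inr]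
  have h1 : ∀ i, min (γ i + (pairing a ℤ i m).toNat) (γ i + (-pairing a ℤ i m).toNat) = γ i :=
    fun i => by omega
  have h2 : (fun i => ((γ i + (pairing a ℤ i m).toNat : ℕ) : ℤ) -
      (γ i + (-pairing a ℤ i m).toNat : ℕ)) = fun i => pairing a ℤ i m := by
    funext i; omega
  simp only [h1, h2]
  rw [hinj.extend_apply]

/-- The ring homomorphism with given values on the functions `z_i w_i` and `xFun a m`. -/
def ringHomOfTwistedCharacter
    (hinj : Function.Injective fun (m : Fin d → ℤ) i => pairing a ℤ i m)
    {η : Fin n → K} {g : (Fin d → ℤ) → K}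
    (hη : ∀ b ∈ lieKernel a, ∑ i, (b i : K) * η i = 0) (hg : IsTwistedCharacter a η g) :
    invariantRing a →+* K where
  toFun r := fiberValue a η g hη r
  map_zero' := by simp
  map_add' x y := by simp
  map_one' := by
    have := fiberValue_prod_hFun_mul_xFun a hinj η g hη 0 0
    simpa [xFun_zero, hg.map_zero] using this
  map_mul' r s := by
    have hval := fiberValue_prod_hFun_mul_xFun a hinj η g hη
    have hr := AddSubgroup.mem_top r
    have hs := AddSubgroup.mem_top s
    rw [← closure_range_prod_hFun_mul_xFun a] at hr hs
    induction hr, hs using AddSubgroup.closure_induction₂ with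
    | mem x y hx hy =>
      obtain ⟨⟨γ, m⟩, rfl⟩ := hx
      obtain ⟨⟨γ', m'⟩, rfl⟩ := hy
      dsimp only
      have h : (∏ i, hFun a i ^ γ i) * xFun a m * ((∏ i, hFun a i ^ γ' i) * xFun a m') =
          (∏ i, hFun a i ^ (γ i + γ' i + overlap (pairing a ℤ i m) (pairing a ℤ i m'))) *
            xFun a (m + m') := by
        rw [mul_mul_mul_comm, xFun_mul_xFun]
        simp only [pow_add, Finset.prod_mul_distrib]
        ring
      rw [h, hval, hval, hval, mul_mul_mul_comm, hg.map_mul]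
      simp only [pow_add, Finset.prod_mul_distrib]
      ring
    | zero_left x _ => simp
    | zero_right x _ => simp
    | add_left x y z _ _ _ h1 h2 =>
      rw [add_mul, Subring.coe_add, map_add, h1, h2, Subring.coe_add, map_add, add_mul]
    | add_right x y z _ _ _ h1 h2 =>
      rw [mul_add, Subring.coe_add, map_add, h1, h2, Subring.coe_add, map_add, mul_add]
    | neg_left x y _ _ h => rw [neg_mul]; simpa using h
    | neg_right x y _ _ h => rw [mul_neg]; simpa using h

variable {a}

theorem isTwistedCharacter_of_ringHom (φ : invariantRing a →+* K) :
    IsTwistedCharacter a (fun i => φ (hFun a i)) (fun m => φ (xFun a m)) where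
  map_zero := by rw [xFun_zero, map_one]
  map_mul m m' := by rw [← map_mul, xFun_mul_xFun]; simp

theorem sum_mul_ringHom_hFun (φ : invariantRing a →+* K) {b : Fin n → ℤ} (hb : b ∈ lieKernel a) :
    ∑ i, (b i : K) * φ (hFun a i) = 0 := by
  have h := congrArg φ (sum_smul_hFun a hb)
  simpa [map_sum] using h

theorem hFun_mem_coordIdeal (i : Fin n) : (hFun a i : ZeroFiberRing a) ∈ coordIdeal a i :=
  Ideal.mul_mem_right _ _ (Ideal.subset_span (Set.mem_insert _ _))

theorem xFun_mem_coordIdeal {i : Fin n} {m : Fin d → ℤ} (hm : pairing a ℤ i m ≠ 0) :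
    (xFun a m : ZeroFiberRing a) ∈ coordIdeal a i := by
  have hdvd : zCoord a i ^ (pairing a ℤ i m).toNat * wCoord a i ^ (-pairing a ℤ i m).toNat ∣
      (xFun a m : ZeroFiberRing a) :=
    Finset.dvd_prod_of_mem (fun i => zCoord a i ^ (pairing a ℤ i m).toNat *
      wCoord a i ^ (-pairing a ℤ i m).toNat) (Finset.mem_univ i)
  refine Ideal.mem_of_dvd _ hdvd ?_
  rcases lt_or_gt_of_ne hm with h | h
  · exact Ideal.mul_mem_left _ _ (Ideal.pow_mem_of_mem _ (Ideal.subset_span (by simp)) _ (by omega))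
  · exact Ideal.mul_mem_right _ _
      (Ideal.pow_mem_of_mem _ (Ideal.subset_span (by simp)) _ (by omega))

/-- A homomorphism does not vanish on the invariants in the ideal `(z_i, w_i)` if and only if it
does not vanish on one of the spanning monomials in this ideal. -/
theorem exists_mem_coordIdeal_iff (φ : invariantRing a →+* K) (i : Fin n) :
    (∃ r : invariantRing a, (r : ZeroFiberRing a) ∈ coordIdeal a i ∧ φ r ≠ 0) ↔
      φ (hFun a i) ≠ 0 ∨ ∃ m, pairing a ℤ i m ≠ 0 ∧ φ (xFun a m) ≠ 0 := by
  constructor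
  · rintro ⟨r, hr, hφ⟩
    by_contra! h
    obtain ⟨hh, hx⟩ := h
    apply hφ
    let ψ : ZeroFiberRing a →+ K := φ.toAddMonoidHom.comp
      ((invariantPart a).codRestrict (invariantRing a) (invariantPart_mem a))
    have hψ : ∀ s : invariantRing a, ψ s = φ s := fun s =>
      congrArg φ (Subtype.ext (invariantPart_of_mem a _ s.2))
    have hmon : ∀ α β : Fin n → ℕ, (1 ≤ α i ∨ 1 ≤ β i) → ψ (zwMonomial a α β) = 0 := by
      intro α β hαβ
      by_cases hm : ∃ m : Fin d → ℤ, ∀ i, pairing a ℤ i m = (α i : ℤ) - β i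
      · obtain ⟨m, hm⟩ := hm
        rw [zwMonomial_eq_prod_hFun_mul_xFun a hm, hψ, map_mul, map_prod]
        rcases Nat.eq_zero_or_pos (min (α i) (β i)) with h0 | h0
        · rw [hx m (by rw [hm]; omega), mul_zero]
        · rw [Finset.prod_eq_zero (Finset.mem_univ i), zero_mul]
          rw [map_pow, hh, zero_pow h0.ne']
      · have h0 := invariantPart_zwMonomial_of_not a 1 hm
        rw [one_smul] at h0
        have : (invariantPart a).codRestrict (invariantRing a) (invariantPart_mem a)
            (zwMonomial a α β) = 0 := Subtype.ext h0
        change φ _ = 0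
        rw [this, map_zero]
    have hz : zwMonomial a (Pi.single i 1) 0 = zCoord a i := by
      rw [zwMonomial, Finset.prod_eq_single i] <;> simp +contextual
    have hw : zwMonomial a 0 (Pi.single i 1) = wCoord a i := by
      rw [zwMonomial, Finset.prod_eq_single i] <;> simp +contextual
    have hmulz : ∀ s, ψ (s * zCoord a i) = 0 := by
      intro s
      induction s using zeroFiberRing_induction with
      | monomial c α β =>
        rw [← hz, smul_mul_assoc, zwMonomial_mul, map_zsmul, hmon _ _ (by simp), smul_zero]
      | add x y hx hy => rw [add_mul, map_add, hx, hy, add_zero]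
    have hmulw : ∀ s, ψ (s * wCoord a i) = 0 := by
      intro s
      induction s using zeroFiberRing_induction with
      | monomial c α β =>
        rw [← hw, smul_mul_assoc, zwMonomial_mul, map_zsmul, hmon _ _ (by simp), smul_zero]
      | add x y hx hy => rw [add_mul, map_add, hx, hy, add_zero]
    obtain ⟨x, y, hxy⟩ := Ideal.mem_span_pair.1 hr
    rw [← hψ, ← hxy, map_add, hmulz, hmulw, add_zero]
  · rintro (h | ⟨m, hm, h⟩)
    · exact ⟨_, hFun_mem_coordIdeal i, h⟩
    · exact ⟨_, xFun_mem_coordIdeal hm, h⟩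

end Homomorphisms

end Hypertoric

/-! ### Points of the generic stratum -/

namespace Hypertoric

variable {d n : ℕ}

/-- The point of `Spec R` under a homomorphism to a field. -/
def kernelPoint {R K : Type} [CommRing R] [Field K] (φ : R →+* K) : Spec (.of R) :=
  (⟨RingHom.ker φ, RingHom.ker_isPrime φ⟩ : PrimeSpectrum R)

theorem specMap_eq_kernelPoint {R K : Type} [CommRing R] [Field K] (φ : R →+* K)
    (x : Spec (.of K)) : Spec.map (CommRingCat.ofHom φ) x = kernelPoint φ := by
  have hx : PrimeSpectrum.asIdeal (R := K) x = ⊥ :=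
    (Ideal.eq_bot_or_top _).resolve_right (PrimeSpectrum.isPrime (R := K) x).ne_top
  refine PrimeSpectrum.ext (R := R) ?_
  change Ideal.comap φ (PrimeSpectrum.asIdeal (R := K) x) = RingHom.ker φ
  rw [hx]
  rfl

/-- The points of an open subscheme of an affine scheme with values in a field. -/
def pointsEquivRingHom {R K : Type} [CommRing R] [Field K] (U : (Spec (.of R)).Opens) :
    (Spec (.of K) ⟶ (U : Scheme.{0})) ≃ {φ : R →+* K // kernelPoint φ ∈ U} where
  toFun f := ⟨(Spec.homEquiv (f ≫ U.ι)).hom, by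
    have x : Spec (.of K) := (⊥ : PrimeSpectrum K)
    rw [← specMap_eq_kernelPoint _ x]
    have h : Spec.map (CommRingCat.ofHom (Spec.homEquiv (f ≫ U.ι)).hom) = f ≫ U.ι :=
      Spec.homEquiv.symm_apply_apply _
    rw [h, Scheme.Hom.comp_apply]
    exact (f x).2⟩
  invFun φ := IsOpenImmersion.lift U.ι (Spec.map (CommRingCat.ofHom φ.1)) (by
    rw [Scheme.Opens.range_ι]
    rintro _ ⟨x, rfl⟩
    rw [specMap_eq_kernelPoint]
    exact φ.2)
  left_inv f := by
    rw [← cancel_mono U.ι, IsOpenImmersion.lift_fac]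
    exact Spec.homEquiv.symm_apply_apply _
  right_inv φ := by
    apply Subtype.ext
    simp only [IsOpenImmersion.lift_fac]
    exact congrArg CommRingCat.Hom.hom (Spec.homEquiv.apply_symm_apply (CommRingCat.ofHom φ.1))

theorem kernelPoint_mem_genericStratum_iff (a : Fin n → Fin d → ℤ) {K : Type} [Field K]
    (φ : invariantRing a →+* K) : kernelPoint φ ∈ genericStratum a ↔
      ∀ i, φ (hFun a i) ≠ 0 ∨ ∃ m, pairing a ℤ i m ≠ 0 ∧ φ (xFun a m) ≠ 0 := by
  refine forall_congr' fun i => ?_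
  rw [← exists_mem_coordIdeal_iff, image_coordLocus]
  change ¬ ((coordIdeal a i).comap (invariantRing a).subtype : Set (invariantRing a)) ⊆
    (RingHom.ker φ : Set (invariantRing a)) ↔ _
  rw [Set.not_subset]
  rfl

/-- The points of the generic stratum are the homomorphisms from the ring of invariants that do not
vanish on the invariants in any of the ideals `(z_i, w_i)`. -/
def genericStratumPointsEquivRingHom (a : Fin n → Fin d → ℤ) (K : Type) [Field K] :
    GenericStratumPoints a K ≃ {φ : invariantRing a →+* K //
      ∀ i, φ (hFun a i) ≠ 0 ∨ ∃ m, pairing a ℤ i m ≠ 0 ∧ φ (xFun a m) ≠ 0} :=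
  (pointsEquivRingHom (R := invariantRing a) (genericStratum a)).trans
    (Equiv.subtypeEquivRight fun φ => kernelPoint_mem_genericStratum_iff a φ)

/-- A twisted character that does not vanish on the invariants in any of the ideals `(z_i, w_i)`. -/
def IsGenericTwistedCharacter (a : Fin n → Fin d → ℤ) {K : Type} [Field K] (η : Fin n → K)
    (g : (Fin d → ℤ) → K) : Prop :=
  IsTwistedCharacter a η g ∧ ∀ i, η i ≠ 0 ∨ ∃ m, pairing a ℤ i m ≠ 0 ∧ g m ≠ 0

/-- The points of the generic stratum fiber over the space of `v ∈ K ^ d`, where `v · a_i` is the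
value of `z_i w_i`. -/
theorem exists_genericStratumPoints_equiv (a : Fin n → Fin d → ℤ)
    (hrank : Module.finrank ℤ (Submodule.span ℤ (Set.range a)) = d) :
    ∃ N : ℕ, ∀ (K : Type) [Field K], N < ringChar K →
      Nonempty (GenericStratumPoints a K ≃ Σ v : Fin d → K,
        {g : (Fin d → ℤ) → K // IsGenericTwistedCharacter a (fun i => pairing a K i v) g}) := by
  obtain ⟨N, hN⟩ := exists_pairing_eq a hrank
  refine ⟨N, fun K _ hK => ⟨(genericStratumPointsEquivRingHom a K).trans ?_⟩⟩
  have hinj : Function.Injective fun (m : Fin d → ℤ) i => pairing a ℤ i m := fun m m' h =>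
    eq_of_pairing_eq a hrank (congrFun h)
  have hη : ∀ (v : Fin d → K), ∀ b ∈ lieKernel a, ∑ i, (b i : K) * pairing a K i v = 0 := by
    intro v b hb
    rw [lieKernel, LinearMap.mem_ker, Fintype.linearCombination_apply] at hb
    simp only [pairing_apply, Finset.mul_sum]
    rw [Finset.sum_comm]
    refine Finset.sum_eq_zero fun j _ => ?_
    have h := congrArg (Int.cast : ℤ → K) (congrFun hb j)
    simp only [Finset.sum_apply, Pi.smul_apply, smul_eq_mul, Pi.zero_apply, Int.cast_sum,
      Int.cast_mul, Int.cast_zero] at h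
    calc ∑ i, (b i : K) * (v j * a i j) = v j * ∑ i, (b i : K) * a i j := by
          rw [Finset.mul_sum]
          exact Finset.sum_congr rfl fun i _ => by ring
      _ = 0 := by rw [h, mul_zero]
  let Φ : (Σ v : Fin d → K, {g : (Fin d → ℤ) → K //
      IsGenericTwistedCharacter a (fun i => pairing a K i v) g}) → invariantRing a →+* K :=
    fun p => ringHomOfTwistedCharacter a hinj (hη p.1) p.2.2.1
  have hval : ∀ p (γ : Fin n → ℕ) (m : Fin d → ℤ), Φ p ((∏ i, hFun a i ^ γ i) * xFun a m) =
      (∏ i, pairing a K i p.1 ^ γ i) * p.2.1 m := fun p γ m =>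
    fiberValue_prod_hFun_mul_xFun a hinj _ _ (hη p.1) γ m
  have hx : ∀ p m, Φ p (xFun a m) = p.2.1 m := fun p m => by
    have h := hval p 0 m
    simpa using h
  have hh : ∀ p i, Φ p (hFun a i) = pairing a K i p.1 := fun p i => by
    have h := hval p (Pi.single i 1) 0
    rw [xFun_zero, p.2.2.1.map_zero, mul_one, mul_one, Finset.prod_eq_single i,
      Finset.prod_eq_single i] at h
    · simpa using h
    all_goals simp +contextual
  have hgen : ∀ p i, Φ p (hFun a i) ≠ 0 ∨ ∃ m, pairing a ℤ i m ≠ 0 ∧ Φ p (xFun a m) ≠ 0 := by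
    intro p
    simpa only [hx, hh] using p.2.2.2
  refine (Equiv.ofBijective (fun p => ⟨Φ p, hgen p⟩) ⟨?_, ?_⟩).symm
  · rintro p q h
    have hpq : Φ p = Φ q := congrArg Subtype.val h
    obtain ⟨v, g, hg⟩ := p
    obtain ⟨v', g', hg'⟩ := q
    obtain rfl : v = v' := by
      refine (hN K hK (fun i => pairing a K i v') (hη v')).unique (fun i => ?_) fun i => rfl
      rw [← hh ⟨v, g, hg⟩, hpq, hh]
    obtain rfl : g = g' := by
      funext m
      exact (hx ⟨v, g, hg⟩ m).symm.trans ((DFunLike.congr_fun hpq _).trans (hx _ m))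
    rfl
  · rintro ⟨φ, hφ⟩
    obtain ⟨v, hv, -⟩ := hN K hK (fun i => φ (hFun a i)) fun b hb => sum_mul_ringHom_hFun φ hb
    have hv' : (fun i => pairing a K i v) = fun i => φ (hFun a i) := funext hv
    refine ⟨⟨v, fun m => φ (xFun a m), ?_⟩, Subtype.ext (ringHom_ext_of_hFun_xFun a ?_ ?_)⟩
    · rw [hv']
      exact ⟨isTwistedCharacter_of_ringHom φ, hφ⟩
    · exact fun i => (hh _ i).trans (hv i)
    · exact fun m => hx _ m

end Hypertoric

/-! ### The fiber over a point: chambers and torus characters -/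

namespace Hypertoric

variable {d n : ℕ} (a : Fin n → Fin d → ℤ)

theorem overlap_of_mul_nonneg {s t : ℤ} (h : 0 ≤ s * t) : overlap s t = 0 := by
  unfold overlap
  rcases mul_nonneg_iff.1 h with ⟨_, _⟩ | ⟨_, _⟩ <;> omega

theorem overlap_ne_zero {s t : ℤ} (h : s * t < 0) : overlap s t ≠ 0 := by
  unfold overlap
  rcases mul_neg_iff.1 h with ⟨_, _⟩ | ⟨_, _⟩ <;> omega

theorem toNat_add_toNat (s t : ℤ) : s.toNat + t.toNat = overlap s t + (s + t).toNat := by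
  unfold overlap
  omega

/-- The lattice points in the closed cone where every form `i ∈ F` has the sign that it has at `m₀`
or vanishes. -/
def signCone (F : Finset (Fin n)) (m₀ : Fin d → ℤ) : AddSubmonoid (Fin d → ℤ) where
  carrier := {m | ∀ i ∈ F, 0 ≤ pairing a ℤ i m₀ * pairing a ℤ i m}
  zero_mem' := by simp
  add_mem' hx hy i hi := by
    rw [map_add, mul_add]
    exact add_nonneg (hx i hi) (hy i hi)

variable {a}

theorem self_mem_signCone (F : Finset (Fin n)) (m₀ : Fin d → ℤ) : m₀ ∈ signCone a F m₀ :=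
  fun _ _ => mul_self_nonneg _

/-- A lattice point is moved into the cone by adding a multiple of an interior point. -/
theorem exists_smul_add_mem_signCone {F : Finset (Fin n)} {m₀ : Fin d → ℤ}
    (hm₀ : ∀ i ∈ F, pairing a ℤ i m₀ ≠ 0) (m : Fin d → ℤ) :
    ∃ k : ℕ, k • m₀ + m ∈ signCone a F m₀ := by
  refine ⟨∑ i, (pairing a ℤ i m).natAbs, fun i hi => ?_⟩
  have h1 : (pairing a ℤ i m).natAbs ≤ ∑ i, (pairing a ℤ i m).natAbs :=
    Finset.single_le_sum (f := fun i => (pairing a ℤ i m).natAbs) (fun _ _ => Nat.zero_le _)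
      (Finset.mem_univ i)
  generalize (∑ i, (pairing a ℤ i m).natAbs) = k at h1
  rw [map_add, map_nsmul, nsmul_eq_mul]
  generalize pairing a ℤ i m = t at *
  have h0 := hm₀ i hi
  generalize pairing a ℤ i m₀ = s at *
  have hs : 1 ≤ |s| := Int.one_le_abs h0
  have ht : |t| ≤ k := by rw [Int.abs_eq_natAbs]; exact_mod_cast h1
  have h2 : |s * t| ≤ |s| * k := by
    rw [abs_mul]; exact mul_le_mul_of_nonneg_left ht (abs_nonneg _)
  have h3 : |s| * k ≤ s * (k * s) := by
    calc |s| * k ≤ |s| * k * |s| := le_mul_of_one_le_right (by positivity) hs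
      _ = k * (|s| * |s|) := by ring
      _ = s * (k * s) := by rw [abs_mul_abs_self]; ring
  have := neg_abs_le (s * t)
  rw [mul_add]
  linarith

/-- A homomorphism from a submonoid `C` of `ℤ ^ d` to an abelian group is the restriction of a
homomorphism from `ℤ ^ d` if `C` contains `u` and all `u + e_j`. -/
theorem addMonoidHom_eq_sum_of_mem {G : Type*} [AddCommGroup G] {C : AddSubmonoid (Fin d → ℤ)}
    (ψ : C →+ G) {u : Fin d → ℤ} (hu : u ∈ C) (huj : ∀ j, u + Pi.single j 1 ∈ C) (m : C) :
    ψ m = ∑ j, m.1 j • (ψ ⟨u + Pi.single j 1, huj j⟩ - ψ ⟨u, hu⟩) := by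
  have h : m + ∑ j, ((-m.1 j).toNat • (⟨u + Pi.single j 1, huj j⟩ : C) +
        (m.1 j).toNat • (⟨u, hu⟩ : C)) =
      ∑ j, ((m.1 j).toNat • (⟨u + Pi.single j 1, huj j⟩ : C) + (-m.1 j).toNat • (⟨u, hu⟩ : C)) := by
    apply Subtype.ext
    simp only [AddSubmonoid.coe_add, AddSubmonoidClass.coe_finsetSum, AddSubmonoidClass.coe_nsmul]
    funext k
    simp only [Pi.add_apply, Finset.sum_apply, Pi.smul_apply]
    simp only [nsmul_eq_mul, mul_add,
      Finset.sum_add_distrib, Pi.single_apply, mul_ite, mul_one, mul_zero, Finset.sum_ite_eq,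
      Finset.mem_univ, if_true]
    have := Int.toNat_sub_toNat_neg (m.1 k)
    linarith
  have h2 := congrArg ψ h
  simp only [map_add, map_sum, map_nsmul] at h2
  rw [← eq_sub_iff_add_eq, ← Finset.sum_sub_distrib] at h2
  rw [h2]
  refine Finset.sum_congr rfl fun j _ => ?_
  have h3 : (m.1 j) = ((m.1 j).toNat : ℤ) - ((-m.1 j).toNat : ℤ) :=
    (Int.toNat_sub_toNat_neg (m.1 j)).symm
  conv_rhs => rw [h3]
  rw [sub_smul, natCast_zsmul, natCast_zsmul, smul_sub, smul_sub]
  abel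

section Fiber

variable {K : Type} [Field K] {F : Finset (Fin n)} {η : Fin n → K}

/-- The twist that turns characters into twisted characters on a cone, where the forms `i ∈ F` have
constant signs. -/
def twist (a : Fin n → Fin d → ℤ) (F : Finset (Fin n)) (η : Fin n → K) (m : Fin d → ℤ) : K :=
  ∏ i ∈ Fᶜ, η i ^ (pairing a ℤ i m).toNat

theorem twist_ne_zero (hF : ∀ i, i ∈ F ↔ η i = 0) (m : Fin d → ℤ) : twist a F η m ≠ 0 :=
  Finset.prod_ne_zero_iff.2 fun i hi => pow_ne_zero _ fun h =>
    (Finset.mem_compl.1 hi) ((hF i).2 h)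

theorem twist_mul_twist {m m' : Fin d → ℤ}
    (h : ∀ i ∈ F, 0 ≤ pairing a ℤ i m * pairing a ℤ i m') :
    twist a F η m * twist a F η m' =
      (∏ i, η i ^ overlap (pairing a ℤ i m) (pairing a ℤ i m')) * twist a F η (m + m') := by
  classical
  have h1 : ∏ i, η i ^ overlap (pairing a ℤ i m) (pairing a ℤ i m') =
      ∏ i ∈ Fᶜ, η i ^ overlap (pairing a ℤ i m) (pairing a ℤ i m') := by
    refine (Finset.prod_subset (Finset.subset_univ _) fun i _ hi => ?_).symm
    rw [overlap_of_mul_nonneg (h i (by simpa using hi)), pow_zero]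
  rw [h1, twist, twist, twist, ← Finset.prod_mul_distrib, ← Finset.prod_mul_distrib]
  refine Finset.prod_congr rfl fun i _ => ?_
  rw [← pow_add, ← pow_add, map_add, toNat_add_toNat]

/-- The character of the lattice `ℤ ^ d` with given values on the standard basis. -/
def latticeCharacter (χ : Fin d → Kˣ) (m : Fin d → ℤ) : Kˣ := ∏ j, χ j ^ m j

theorem latticeCharacter_add (χ : Fin d → Kˣ) (m m' : Fin d → ℤ) :
    latticeCharacter χ (m + m') = latticeCharacter χ m * latticeCharacter χ m' := by
  simp [latticeCharacter, zpow_add, Finset.prod_mul_distrib]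

theorem latticeCharacter_zero (χ : Fin d → Kˣ) : latticeCharacter χ 0 = 1 := by
  simp [latticeCharacter]

theorem latticeCharacter_single (χ : Fin d → Kˣ) (j : Fin d) :
    latticeCharacter χ (Pi.single j 1) = χ j := by
  classical
  rw [latticeCharacter, Finset.prod_eq_single j]
  · simp
  · intro k _ hk
    simp [hk]
  · simp

/-- The function that is a twisted character of `ℤ ^ d` on the cone around `m₀` and zero off this
cone. -/
def coneFunction (a : Fin n → Fin d → ℤ) (F : Finset (Fin n)) (η : Fin n → K) (m₀ : Fin d → ℤ)
    (χ : Fin d → Kˣ) (m : Fin d → ℤ) : K :=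
  open Classical in
  if m ∈ signCone a F m₀ then twist a F η m * (latticeCharacter χ m : K) else 0

theorem coneFunction_ne_zero_iff (hF : ∀ i, i ∈ F ↔ η i = 0) (m₀ : Fin d → ℤ) (χ : Fin d → Kˣ)
    (m : Fin d → ℤ) : coneFunction a F η m₀ χ m ≠ 0 ↔ m ∈ signCone a F m₀ := by
  rw [coneFunction]
  split_ifs with h
  · exact iff_of_true (mul_ne_zero (twist_ne_zero hF m) (Units.ne_zero _)) h
  · exact iff_of_false (by simp) h

theorem mul_nonneg_of_mem_signCone {m₀ m m' : Fin d → ℤ} (hm₀ : ∀ i ∈ F, pairing a ℤ i m₀ ≠ 0)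
    (hm : m ∈ signCone a F m₀) (hm' : m' ∈ signCone a F m₀) {i : Fin n} (hi : i ∈ F) :
    0 ≤ pairing a ℤ i m * pairing a ℤ i m' := by
  have h1 := mul_nonneg (hm i hi) (hm' i hi)
  rw [mul_mul_mul_comm] at h1
  exact nonneg_of_mul_nonneg_right h1 (mul_self_pos.2 (hm₀ i hi))

theorem isGenericTwistedCharacter_coneFunction (hF : ∀ i, i ∈ F ↔ η i = 0) {m₀ : Fin d → ℤ}
    (hm₀ : ∀ i ∈ F, pairing a ℤ i m₀ ≠ 0) (χ : Fin d → Kˣ) :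
    IsGenericTwistedCharacter a η (coneFunction a F η m₀ χ) := by
  refine ⟨⟨?_, fun m m' => ?_⟩, fun i => ?_⟩
  · rw [coneFunction, if_pos (zero_mem _), latticeCharacter_zero, twist]
    simp
  · by_cases hadd : m + m' ∈ signCone a F m₀
    · by_cases h : m ∈ signCone a F m₀ ∧ m' ∈ signCone a F m₀
      · obtain ⟨hm, hm'⟩ := h
        rw [coneFunction, coneFunction, coneFunction, if_pos hm, if_pos hm', if_pos hadd,
          latticeCharacter_add, mul_mul_mul_comm,
          twist_mul_twist fun i hi => mul_nonneg_of_mem_signCone hm₀ hm hm' hi, mul_assoc,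
          Units.val_mul]
      · -- Some form in `F` has opposite signs at `m` and `m'`, so both sides vanish.
        have h0 : coneFunction a F η m₀ χ m * coneFunction a F η m₀ χ m' = 0 := by
          by_contra h0
          exact h ⟨(coneFunction_ne_zero_iff hF m₀ χ m).1 (left_ne_zero_of_mul h0),
            (coneFunction_ne_zero_iff hF m₀ χ m').1 (right_ne_zero_of_mul h0)⟩
        have key : ∃ i ∈ F, pairing a ℤ i m * pairing a ℤ i m' < 0 := by
          by_contra! hcon
          have hnn : ∀ i ∈ F, 0 ≤ (pairing a ℤ i m₀ * pairing a ℤ i m) *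
              (pairing a ℤ i m₀ * pairing a ℤ i m') := fun i hi => by
            rw [mul_mul_mul_comm]
            exact mul_nonneg (mul_self_nonneg _) (hcon i hi)
          have hsum : ∀ i ∈ F, 0 ≤ pairing a ℤ i m₀ * pairing a ℤ i m +
              pairing a ℤ i m₀ * pairing a ℤ i m' := fun i hi => by
            rw [← mul_add, ← map_add]
            exact hadd i hi
          refine h ⟨fun i hi => ?_, fun i hi => ?_⟩
          · by_contra! hlt
            exact (hnn i hi).not_gt (mul_neg_of_neg_of_pos hlt (by linarith [hsum i hi]))
          · by_contra! hlt
            exact (hnn i hi).not_gt (mul_neg_of_pos_of_neg (by linarith [hsum i hi]) hlt)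
        obtain ⟨i, hi, hlt⟩ := key
        rw [h0, Finset.prod_eq_zero (Finset.mem_univ i), zero_mul]
        rw [(hF i).1 hi, zero_pow (overlap_ne_zero hlt)]
    · have h0 : coneFunction a F η m₀ χ m * coneFunction a F η m₀ χ m' = 0 := by
        by_contra h0
        exact hadd (add_mem ((coneFunction_ne_zero_iff hF m₀ χ m).1 (left_ne_zero_of_mul h0))
          ((coneFunction_ne_zero_iff hF m₀ χ m').1 (right_ne_zero_of_mul h0)))
      have h1 : coneFunction a F η m₀ χ (m + m') = 0 := if_neg hadd
      rw [h0, h1, mul_zero]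
  · by_cases hi : i ∈ F
    · exact Or.inr ⟨m₀, hm₀ i hi,
        (coneFunction_ne_zero_iff hF m₀ χ m₀).2 (self_mem_signCone F m₀)⟩
    · exact Or.inl fun h => hi ((hF i).2 h)

theorem IsTwistedCharacter.add_ne_zero {g : (Fin d → ℤ) → K} (hg : IsTwistedCharacter a η g)
    {m m' : Fin d → ℤ} (hm : g m ≠ 0) (hm' : g m' ≠ 0) : g (m + m') ≠ 0 := by
  have h := mul_ne_zero hm hm'
  rw [hg.map_mul] at h
  exact right_ne_zero_of_mul h

/-- A form whose `η i` vanishes does not take opposite signs on the support of a twisted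
character. -/
theorem IsTwistedCharacter.mul_nonneg {g : (Fin d → ℤ) → K} (hg : IsTwistedCharacter a η g)
    {m m' : Fin d → ℤ} (hm : g m ≠ 0) (hm' : g m' ≠ 0) {i : Fin n} (hi : η i = 0) :
    0 ≤ pairing a ℤ i m * pairing a ℤ i m' := by
  by_contra! hlt
  have h := mul_ne_zero hm hm'
  rw [hg.map_mul, Finset.prod_eq_zero (Finset.mem_univ i), zero_mul] at h
  · exact h rfl
  · rw [hi, zero_pow (overlap_ne_zero hlt)]

theorem IsTwistedCharacter.nsmul_ne_zero {g : (Fin d → ℤ) → K} (hg : IsTwistedCharacter a η g)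
    {m : Fin d → ℤ} (hm : g m ≠ 0) (k : ℕ) : g (k • m) ≠ 0 := by
  induction k with
  | zero => rw [zero_smul, hg.map_zero]; exact one_ne_zero
  | succ k ih => rw [succ_nsmul]; exact hg.add_ne_zero ih hm

/-- The support of a generic twisted character contains a point off all hyperplanes in `F`. -/
theorem IsGenericTwistedCharacter.exists_interior {g : (Fin d → ℤ) → K}
    (hg : IsGenericTwistedCharacter a η g) (hF : ∀ i, i ∈ F ↔ η i = 0) :
    ∃ m₀, g m₀ ≠ 0 ∧ ∀ i ∈ F, pairing a ℤ i m₀ ≠ 0 := by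
  classical
  have h : ∀ S ⊆ F, ∃ m₀, g m₀ ≠ 0 ∧ ∀ i ∈ S, pairing a ℤ i m₀ ≠ 0 := by
    intro S
    induction S using Finset.induction_on with
    | empty => exact fun _ => ⟨0, by rw [hg.1.map_zero]; exact one_ne_zero, by simp⟩
    | insert i S hi ih =>
      intro hS
      obtain ⟨m, hm, hmS⟩ := ih ((Finset.subset_insert i S).trans hS)
      have hiF := (hF i).1 (hS (Finset.mem_insert_self i S))
      obtain ⟨m', him', hm'⟩ := (hg.2 i).resolve_left (not_not.2 hiF)
      refine ⟨m + m', hg.1.add_ne_zero hm hm', fun k hk => ?_⟩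
      -- As the values at `m` and `m'` do not have opposite signs, they do not cancel.
      have hnn := hg.1.mul_nonneg hm hm' ((hF k).1 (hS hk))
      rw [map_add]
      intro h0
      have h1 : pairing a ℤ k m = 0 ∧ pairing a ℤ k m' = 0 := by
        have h2 : pairing a ℤ k m' = -pairing a ℤ k m := by linarith
        rw [h2, mul_neg, Left.nonneg_neg_iff] at hnn
        have h3 : pairing a ℤ k m = 0 := mul_self_eq_zero.1 (le_antisymm hnn (mul_self_nonneg _))
        exact ⟨h3, by rw [h2, h3, neg_zero]⟩
      rcases Finset.mem_insert.1 hk with rfl | hk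
      · exact him' h1.2
      · exact hmS k hk h1.1
  exact h F subset_rfl

/-- The support of a twisted character that contains an interior point of a cone is the cone. -/
theorem IsTwistedCharacter.ne_zero_iff {g : (Fin d → ℤ) → K} (hg : IsTwistedCharacter a η g)
    (hF : ∀ i, i ∈ F ↔ η i = 0) {m₀ : Fin d → ℤ} (h₀ : g m₀ ≠ 0)
    (hm₀ : ∀ i ∈ F, pairing a ℤ i m₀ ≠ 0) (m : Fin d → ℤ) :
    g m ≠ 0 ↔ m ∈ signCone a F m₀ := by
  refine ⟨fun hm i hi => hg.mul_nonneg h₀ hm ((hF i).1 hi), fun hm => ?_⟩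
  obtain ⟨k, hk⟩ := exists_smul_add_mem_signCone hm₀ (-m)
  have h := hg.map_mul m (k • m₀ + -m)
  rw [add_comm m, neg_add_cancel_right] at h
  have hne : g m * g (k • m₀ + -m) ≠ 0 := by
    rw [h]
    refine mul_ne_zero (Finset.prod_ne_zero_iff.2 fun i _ => ?_) (hg.nsmul_ne_zero h₀ k)
    by_cases hi : i ∈ F
    · rw [overlap_of_mul_nonneg (mul_nonneg_of_mem_signCone hm₀ hm hk hi), pow_zero]
      exact one_ne_zero
    · exact pow_ne_zero _ fun h => hi ((hF i).2 h)
  exact left_ne_zero_of_mul hne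

theorem exists_mem_signCone_add_single {m₀ : Fin d → ℤ} (hm₀ : ∀ i ∈ F, pairing a ℤ i m₀ ≠ 0) :
    ∃ u ∈ signCone a F m₀, ∀ j, u + Pi.single j 1 ∈ signCone a F m₀ := by
  choose k hk using fun j : Fin d => exists_smul_add_mem_signCone hm₀ (Pi.single j (1 : ℤ))
  refine ⟨(∑ j, k j) • m₀, nsmul_mem (self_mem_signCone F m₀) _, fun j => ?_⟩
  classical
  rw [← Finset.add_sum_erase _ _ (Finset.mem_univ j), add_smul, add_comm (k j • m₀), add_assoc]
  exact add_mem (nsmul_mem (self_mem_signCone F m₀) _) (hk j)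

theorem coneFunction_character_injective (hF : ∀ i, i ∈ F ↔ η i = 0) {m₀ : Fin d → ℤ}
    (hm₀ : ∀ i ∈ F, pairing a ℤ i m₀ ≠ 0) {χ χ' : Fin d → Kˣ}
    (h : coneFunction a F η m₀ χ = coneFunction a F η m₀ χ') : χ = χ' := by
  obtain ⟨u, hu, huj⟩ := exists_mem_signCone_add_single (a := a) hm₀
  have key : ∀ m ∈ signCone a F m₀, latticeCharacter χ m = latticeCharacter χ' m := by
    intro m hm
    have h1 := congrFun h m
    rw [coneFunction, coneFunction, if_pos hm, if_pos hm] at h1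
    exact Units.ext (mul_left_cancel₀ (twist_ne_zero hF m) h1)
  funext j
  have h1 := key _ (huj j)
  rw [latticeCharacter_add, latticeCharacter_add, key u hu] at h1
  simpa [latticeCharacter_single] using mul_left_cancel h1

theorem exists_eq_coneFunction {g : (Fin d → ℤ) → K} (hg : IsTwistedCharacter a η g)
    (hF : ∀ i, i ∈ F ↔ η i = 0) {m₀ : Fin d → ℤ} (h₀ : g m₀ ≠ 0)
    (hm₀ : ∀ i ∈ F, pairing a ℤ i m₀ ≠ 0) : ∃ χ, g = coneFunction a F η m₀ χ := by
  have hsupp := hg.ne_zero_iff hF h₀ hm₀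
  obtain ⟨u, hu, huj⟩ := exists_mem_signCone_add_single (a := a) hm₀
  -- After untwisting, `g` becomes a homomorphism from the cone to the group of units.
  let ψ : signCone a F m₀ →+ Additive Kˣ :=
    { toFun := fun m => Additive.ofMul
        (Units.mk0 (g m) ((hsupp m).2 m.2) * (Units.mk0 (twist a F η m) (twist_ne_zero hF _))⁻¹)
      map_zero' := by
        rw [ofMul_eq_zero, mul_inv_eq_one]
        apply Units.ext
        simp [hg.map_zero, twist]
      map_add' := fun m m' => by
        rw [← ofMul_mul, mul_mul_mul_comm, ← mul_inv]
        congr 1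
        rw [mul_inv_eq_iff_eq_mul, mul_right_comm, eq_mul_inv_iff_mul_eq]
        apply Units.ext
        simp only [Units.val_mul, Units.val_mk0, AddSubmonoid.coe_add]
        rw [twist_mul_twist fun i hi => mul_nonneg_of_mem_signCone hm₀ m.2 m'.2 hi, hg.map_mul]
        ring }
  refine ⟨fun j => (ψ ⟨_, huj j⟩ - ψ ⟨u, hu⟩).toMul, funext fun m => ?_⟩
  rw [coneFunction]
  split_ifs with hm
  · have h := congrArg Additive.toMul (addMonoidHom_eq_sum_of_mem ψ hu huj ⟨m, hm⟩)
    rw [toMul_sum] at h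
    simp only [toMul_zsmul] at h
    rw [latticeCharacter, ← h]
    change g m = twist a F η m * (g m * (twist a F η m)⁻¹)
    rw [mul_left_comm, mul_inv_cancel₀ (twist_ne_zero hF m), mul_one]
  · by_contra h
    exact hm ((hsupp m).1 h)

theorem signCone_eq_of_sign_eq {m₀ m₁ : Fin d → ℤ}
    (h : ∀ i ∈ F, SignType.sign (pairing a ℤ i m₀) = SignType.sign (pairing a ℤ i m₁)) :
    signCone a F m₀ = signCone a F m₁ := by
  ext m
  refine forall₂_congr fun i hi => ?_
  rw [← sign_nonneg_iff, sign_mul, h i hi, ← sign_mul, sign_nonneg_iff]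

theorem sign_eq_of_signCone_eq {m₀ m₁ : Fin d → ℤ} (h₀ : ∀ i ∈ F, pairing a ℤ i m₀ ≠ 0)
    (h₁ : ∀ i ∈ F, pairing a ℤ i m₁ ≠ 0) (h : signCone a F m₀ = signCone a F m₁) {i : Fin n}
    (hi : i ∈ F) : SignType.sign (pairing a ℤ i m₀) = SignType.sign (pairing a ℤ i m₁) := by
  have h2 : m₁ ∈ signCone a F m₀ := h ▸ self_mem_signCone F m₁
  exact sign_eq_of_mul_pos (lt_of_le_of_ne (h2 i hi) (mul_ne_zero (h₀ i hi) (h₁ i hi)).symm)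

/-- Generic twisted characters correspond to pairs of a chamber and a point of the torus. -/
theorem exists_chamber_prod_equiv (hF : ∀ i, i ∈ F ↔ η i = 0) :
    Nonempty (Chamber a F × (Fin d → Kˣ) ≃
      {g : (Fin d → ℤ) → K // IsGenericTwistedCharacter a η g}) := by
  choose m₀ hm₀ using fun c : Chamber a F => c.2
  have hne : ∀ c, ∀ i ∈ F, pairing a ℤ i (m₀ c) ≠ 0 := fun c i hi => (hm₀ c ⟨i, hi⟩).1
  refine ⟨Equiv.ofBijective (fun p => ⟨coneFunction a F η (m₀ p.1) p.2,
    isGenericTwistedCharacter_coneFunction hF (hne p.1) p.2⟩) ⟨?_, ?_⟩⟩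
  · rintro ⟨c, χ⟩ ⟨c', χ'⟩ h
    have h1 : coneFunction a F η (m₀ c) χ = coneFunction a F η (m₀ c') χ' :=
      congrArg Subtype.val h
    have hcone : signCone a F (m₀ c) = signCone a F (m₀ c') := by
      ext m
      rw [← coneFunction_ne_zero_iff hF (m₀ c) χ, h1, coneFunction_ne_zero_iff hF]
    obtain rfl : c = c' := by
      refine Subtype.ext (funext fun i => ?_)
      rw [(hm₀ c i).2, (hm₀ c' i).2]
      exact sign_eq_of_signCone_eq (hne c) (hne c') hcone i.2
    rw [coneFunction_character_injective hF (hne c) h1]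
  · rintro ⟨g, hg⟩
    obtain ⟨m, hm, hmF⟩ := hg.exists_interior hF
    let c : Chamber a F := ⟨fun i => SignType.sign (pairing a ℤ i m), m, fun i => ⟨hmF i i.2, rfl⟩⟩
    have hcone : signCone a F m = signCone a F (m₀ c) :=
      signCone_eq_of_sign_eq fun i hi => (hm₀ c ⟨i, hi⟩).2
    obtain ⟨χ, hχ⟩ := exists_eq_coneFunction hg.1 hF (m₀ := m₀ c)
      ((hg.1.ne_zero_iff hF hm hmF _).2 (hcone ▸ self_mem_signCone F (m₀ c))) (hne c)
    exact ⟨(c, χ), Subtype.ext hχ.symm⟩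

end Fiber

/-! ### The point count -/

theorem pointCountPolynomial_eq {X : (K : Type) → [Field K] → Type} {ν : Polynomial ℤ}
    (h : HasPointCount X ν) : pointCountPolynomial X = ν := by
  have h' : HasPolynomialPointCount X := ⟨ν, h⟩
  rw [pointCountPolynomial, dif_pos h']
  exact h'.choose_spec.unique h

theorem hasPolynomialPointCount_restrictionComplement (a : Fin n → Fin d → ℤ)
    (F : Finset (Fin n)) : HasPolynomialPointCount (fun K _ => RestrictionComplement a F K) :=
  (hasPolynomialPointCount_exactZeroLocus a F).imp fun ν =>
    (hasPointCount_restrictionComplement_iff a F ν).2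

theorem hasPointCount_restrictionCharPoly (a : Fin n → Fin d → ℤ) (F : Finset (Fin n)) :
    HasPointCount (fun K _ => ExactZeroLocus a F K) (restrictionCharPoly a F) := by
  obtain ⟨ν, hν⟩ := hasPolynomialPointCount_restrictionComplement a F
  rw [restrictionCharPoly, pointCountPolynomial_eq hν]
  exact (hasPointCount_restrictionComplement_iff a F ν).1 hν

theorem hasPointCount_genericStratumPoints (a : Fin n → Fin d → ℤ)
    (hrank : Module.finrank ℤ (Submodule.span ℤ (Set.range a)) = d) :
    HasPointCount (fun K _ => GenericStratumPoints a K)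
      ((Polynomial.X - 1) ^ d * ∑ F ∈ flats a,
        restrictionCharPoly a F * (localizationRegions a F : Polynomial ℤ)) := by
  classical
  obtain ⟨N₁, hN₁⟩ := exists_genericStratumPoints_equiv a hrank
  obtain ⟨N₂, hN₂⟩ := exists_mem_flats_of_exactZeroLocus a
  choose N hN using hasPointCount_restrictionCharPoly a
  refine ⟨max (max N₁ N₂) (Finset.univ.sup N), fun K _ _ hK => ?_⟩
  obtain ⟨e⟩ := hN₁ K (by omega)
  let Z : (Fin d → K) → Finset (Fin n) := fun v => Finset.univ.filter fun i => pairing a K i v = 0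
  have hZ : ∀ v i, i ∈ Z v ↔ pairing a K i v = 0 := fun v i => by simp [Z]
  have hfiber := fun v : Fin d → K => exists_chamber_prod_equiv (a := a) (hZ v)
  have hfin : ∀ v : Fin d → K, Finite {g : (Fin d → ℤ) → K //
      IsGenericTwistedCharacter a (fun i => pairing a K i v) g} := fun v =>
    (hfiber v).elim fun E => Finite.of_equiv _ E
  have hcard : ∀ v : Fin d → K, Nat.card {g : (Fin d → ℤ) → K //
      IsGenericTwistedCharacter a (fun i => pairing a K i v) g} =
      localizationRegions a (Z v) * (Nat.card K - 1) ^ d := fun v => by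
    obtain ⟨E⟩ := hfiber v
    rw [← Nat.card_congr E, Nat.card_prod, ← localizationRegions_eq_card_chamber, Nat.card_fun,
      Nat.card_fin, Nat.card_units]
  refine ⟨Finite.of_equiv _ e.symm, ?_⟩
  have : Fintype K := Fintype.ofFinite K
  rw [Nat.card_congr e, Nat.card_sigma]
  simp only [hcard]
  rw [← Finset.sum_fiberwise_of_maps_to (g := Z) (t := flats a)
    fun v _ => hN₂ K (by omega) (Z v) v (hZ v)]
  have hZcard : ∀ F, (∑ v : Fin d → K with Z v = F,
      localizationRegions a (Z v) * (Nat.card K - 1) ^ d) =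
      Nat.card (ExactZeroLocus a F K) * (localizationRegions a F * (Nat.card K - 1) ^ d) := by
    intro F
    rw [Finset.sum_congr rfl (g := fun _ => localizationRegions a F * (Nat.card K - 1) ^ d)
      fun v hv => by rw [(Finset.mem_filter.1 hv).2], Finset.sum_const, smul_eq_mul]
    congr 1
    rw [ExactZeroLocus, Nat.card_eq_fintype_card, Fintype.card_subtype]
    congr 1
    ext v
    simp only [Finset.mem_filter, Finset.mem_univ, true_and]
    rw [Finset.ext_iff]
    exact forall_congr' fun i => by rw [hZ]; exact iff_comm
  simp only [hZcard]
  have hK1 : 1 ≤ Nat.card K := Nat.card_pos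
  rw [Polynomial.eval_mul, Polynomial.eval_finsetSum, Polynomial.eval_pow, Polynomial.eval_sub,
    Polynomial.eval_X, Polynomial.eval_one, Finset.mul_sum]
  push_cast [hK1]
  refine Finset.sum_congr rfl fun F _ => ?_
  have hNF : N F ≤ Finset.univ.sup N := Finset.le_sup (Finset.mem_univ F)
  rw [Polynomial.eval_mul, Polynomial.eval_natCast, ← (hN F K (by omega)).2]
  ring

end Hypertoric

end

theorem proposition4p2 {d n : ℕ} (a : Fin n → Fin d → ℤ) (ha : ∀ i, a i ≠ 0)
    (hrank : Module.finrank ℤ (Submodule.span ℤ (Set.range a)) = d) :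
    (∀ F ∈ Hypertoric.flats a,
      HasPolynomialPointCount (fun K _ => Hypertoric.RestrictionComplement a F K)) ∧
    HasPolynomialPointCount (fun K _ => Hypertoric.GenericStratumPoints a K) ∧
    pointCountPolynomial (fun K _ => Hypertoric.GenericStratumPoints a K) =
      (Polynomial.X - 1) ^ d *
        ∑ F ∈ Hypertoric.flats a,
          Hypertoric.restrictionCharPoly a F *
            (Hypertoric.localizationRegions a F : Polynomial ℤ) := by
  have h := Hypertoric.hasPointCount_genericStratumPoints a hrank
  exact ⟨fun F _ => Hypertoric.hasPolynomialPointCount_restrictionComplement a F, ⟨_, h⟩,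
    Hypertoric.pointCountPolynomial_eq h⟩
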